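/- **Theorem 1.2.** The twist-invariant orientability type $\mathrm{tot}$ of a dessin d'enfant is independent of its monodromy group, point stabilisers and automorphism group (as abstract groups) and of its passport. More precisely: *Conventions.* A dessin with (finite, non-empty) edge set $E$ is given by two permutations $\sigma_0,\sigma_1$ of $E$ (the rotations of edges around white and black vertices) generating a transitive group, its monodromy group; put $\sigma_\infty=(\sigma_0\sigma_1)^{-1}$. The white vertices, black vertices and faces are the cycles of $\sigma_0,\sigma_1,\sigma_\infty$, their degrees are the cycle lengths, the passport is the triple of multisets of these degrees, and the type is the triple $(a,b,c)$ of their least common multiples. The dessin is uniform if all white vertices have degree $a$, all black vertices degree $b$ and all faces degree $c$. The automorphism group consists of the permutations of $E$ commuting with $\sigma_0$ and $\sigma_1$. The dessin is Z-orientable if its faces can be labelled $+$ or $-$ so that each edge is incident with faces having different labels. If $\mathcal D$ corresponds to $(\sigma_0,\sigma_1,\sigma_\infty)$, let $\mathcal D'$ and $\mathcal D''$ correspond to $(\sigma_1,\sigma_\infty,\sigma_0)$ and $(\sigma_\infty,\sigma_0,\sigma_1)$; then $\mathrm{tot}(\mathcal D)$ is the number of Z-orientable dessins in the triple $\mathcal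 D,\mathcal D',\mathcal D''$. *The two groups of the cube.* Let $Q$ be the group of permutations of the six faces of a cube induced by its rotations, and $P$ the group of those induced by the isometries of the cube preserving each of its two inscribed regular tetrahedra. Then $P\cong S_4\cong Q$, but $P$ and $Q$ are not conjugate in the group $S_6$ of all permutations of the six faces. *The dessins.* Let $n\ge 8$, and let $A$ and $B$ be subgroups of $S_n$ acting as $P$ and $Q$, respectively, on the same set of six points, identified with the faces of the cube, and fixing the remaining $n-6$ points. Put $M=S_n\times S_n$ and $$H_0=B\times B,\quad H_1=B\times A,\quad H_2=A\times B,\quad H_3=A\times A .$$ Then there are elements $m_0,m_1$ generating $M$ such that the four dessins $\mathcal D_i$ $(i=0,1,2,3)$, whose edges are the cosets of $H_i$ in $M$ and whose permutations $\sigma_0,\sigma_1$ are induced by $m_0,m_1$, have the following properties: 1. the subgroups $H_0,H_1,H_2,H_3$ are pairwise non-conjugate in $M$; 2. each $\mathcal D_i$ has degree $(n!/4!)^2$ and is uniform, and all four have the same type and the same passport; 3. each $\mathcal D_i$ has monodromy group isomorphic to $S_n\times S_n$, edge stabilisers (in the monodromy group) isomorphic to $S_4\times S_4$, and automorphism group isomorphic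 to $(S_2\times S_{n-6})\times(S_2\times S_{n-6})$; 4. $\mathrm{tot}(\mathcal D_0)=0$, $\mathrm{tot}(\mathcal D_1)=\mathrm{tot}(\mathcal D_2)=1$ and $\mathrm{tot}(\mathcal D_3)=3$; 5. $\mathcal D_2$ is Z-orientable and $\mathcal D_1$ is not. -/

import Mathlib

/-!
# Dessins d'enfants through their permutation representations

A dessin d'enfant with edge set `E` is a pair of permutations `σ₀`, `σ₁` of `E`, giving the
cyclic order of the edges around the white and around the black vertices, and generating a
transitive group (the bipartite graph is connected).  The white vertices, black vertices and
faces are the cycles of `σ₀`, `σ₁` and `σ∞ = (σ₀ σ₁)⁻¹`, cycles of length one included.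
Permutations are composed as functions.
-/

open Equiv

/-- A dessin d'enfant with edge set `E`, as a transitive pair of permutations. -/
structure Dessin (E : Type*) where
  /-- The rotation of the edges around the white vertices. -/
  σ₀ : Perm E
  /-- The rotation of the edges around the black vertices. -/
  σ₁ : Perm E
  finite : Finite E
  nonempty : Nonempty E
  transitive : MulAction.IsPretransitive (Subgroup.closure {σ₀, σ₁}) E

/-- The cycles of a permutation `σ`, including those of length one. -/
abbrev CycleOf {E : Type*} (σ : Perm E) : Type _ := Quotient (Perm.SameCycle.setoid σ)

/-- The cycle of `σ` containing `e`. -/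
abbrev toCycle {E : Type*} (σ : Perm E) (e : E) : CycleOf σ :=
  Quotient.mk (Perm.SameCycle.setoid σ) e

/-- The multiset of the lengths of the cycles of `σ`, including those of length one. -/
noncomputable def cycleLengths {E : Type*} [Finite E] (σ : Perm E) : Multiset ℕ :=
  letI : Fintype (CycleOf σ) := Fintype.ofFinite _
  (Finset.univ : Finset (CycleOf σ)).val.map fun v => Nat.card {e : E // toCycle σ e = v}

namespace Dessin

variable {E : Type*}

/-- The monodromy at infinity, determined by `σ₀ σ₁ σ∞ = 1`. -/
def σinf (D : Dessin E) : Perm E := (D.σ₀ * D.σ₁)⁻¹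

/-- The faces are the cycles of `σ∞`. -/
abbrev Face (D : Dessin E) : Type _ := CycleOf D.σinf

/-- The number of edges. -/
noncomputable def degree (_D : Dessin E) : ℕ := Nat.card E

/-- The passport: the degrees of the white vertices, of the black vertices and of the faces. -/
noncomputable def passport (D : Dessin E) : Multiset ℕ × Multiset ℕ × Multiset ℕ :=
  haveI := D.finite
  (cycleLengths D.σ₀, cycleLengths D.σ₁, cycleLengths D.σinf)

/-- The type: the least common multiples of the degrees of the white vertices, of the black
vertices and of the faces. -/
noncomputable def type (D : Dessin E) : ℕ × ℕ × ℕ :=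
  (D.passport.1.lcm, D.passport.2.1.lcm, D.passport.2.2.lcm)

/-- A dessin of type `(a, b, c)` is uniform if all white vertices have degree `a`, all black
vertices have degree `b` and all faces have degree `c`. -/
def IsUniform (D : Dessin E) : Prop :=
  (∀ d ∈ D.passport.1, d = D.type.1) ∧ (∀ d ∈ D.passport.2.1, d = D.type.2.1) ∧
    ∀ d ∈ D.passport.2.2, d = D.type.2.2

/-- The monodromy group, generated by `σ₀` and `σ₁`. -/
def monodromyGroup (D : Dessin E) : Subgroup (Perm E) := Subgroup.closure {D.σ₀, D.σ₁}

/-- The stabiliser of the edge `e` in the monodromy group. -/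
def edgeStabilizer (D : Dessin E) (e : E) : Subgroup D.monodromyGroup :=
  MulAction.stabilizer D.monodromyGroup e

/-- The automorphism group: the permutations of the edges commuting with `σ₀` and `σ₁`. -/
def automorphismGroup (D : Dessin E) : Subgroup (Perm E) := Subgroup.centralizer {D.σ₀, D.σ₁}

/-- The face on one side of the edge `e`. -/
def rightFace (D : Dessin E) (e : E) : D.Face := toCycle D.σinf e

/-- The face on the other side of the edge `e`.  The corner between `e` and `σ₀ e` at the white
vertex of `e` lies between these two edges, so the far side of `e` is the near side of `σ₀ e`. -/
def leftFace (D : Dessin E) (e : E) : D.Face := toCycle D.σinf (D.σ₀ e)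

/-- A dessin is Z-orientable if its faces can be labelled with two signs in such a way that each
edge is incident with faces having different labels. -/
def IsZOrientable (D : Dessin E) : Prop :=
  ∃ label : D.Face → ℤˣ, ∀ e : E, label (D.leftFace e) ≠ label (D.rightFace e)

/-- The twisted dessin `D'`, which replaces `(σ₀, σ₁, σ∞)` with `(σ₁, σ∞, σ₀)`. -/
def twist (D : Dessin E) : Dessin E where
  σ₀ := D.σ₁
  σ₁ := D.σinf
  finite := D.finite
  nonempty := D.nonempty
  transitive := by
    have h : Subgroup.closure {D.σ₁, D.σinf} = Subgroup.closure {D.σ₀, D.σ₁} := by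
      apply le_antisymm
      · rw [Subgroup.closure_le]
        have h0 : D.σ₀ ∈ Subgroup.closure {D.σ₀, D.σ₁} := Subgroup.subset_closure (by simp)
        have h1 : D.σ₁ ∈ Subgroup.closure {D.σ₀, D.σ₁} := Subgroup.subset_closure (by simp)
        rintro x (rfl | rfl)
        · exact h1
        · exact inv_mem (mul_mem h0 h1)
      · rw [Subgroup.closure_le]
        have h1 : D.σ₁ ∈ Subgroup.closure {D.σ₁, D.σinf} := Subgroup.subset_closure (by simp)
        have h2 : D.σinf ∈ Subgroup.closure {D.σ₁, D.σinf} := Subgroup.subset_closure (by simp)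
        rintro x (rfl | rfl)
        · have h3 := mul_mem (inv_mem h2) (inv_mem h1)
          simpa [σinf] using h3
        · exact h1
    rw [h]
    exact D.transitive

/-- The twist-invariant orientability type: the number of Z-orientable dessins among the triple
`D`, `D'`, `D''`. -/
noncomputable def tot (D : Dessin E) : ℕ :=
  Nat.card {k : Fin 3 // (twist^[k.val] D).IsZOrientable}

/-- The dessin of the tuple `(M, H, m₀, m₁, (m₀ m₁)⁻¹)`: the edges are the cosets of `H` in the
finite group `M`, and `σ₀`, `σ₁` are the permutations induced by the generators `m₀`, `m₁`. -/
def ofCosets {M : Type*} [Group M] [Finite M] (H : Subgroup M) (m₀ m₁ : M)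
    (hgen : Subgroup.closure {m₀, m₁} = ⊤) : Dessin (M ⧸ H) where
  σ₀ := MulAction.toPermHom M (M ⧸ H) m₀
  σ₁ := MulAction.toPermHom M (M ⧸ H) m₁
  finite := inferInstance
  nonempty := inferInstance
  transitive := by
    refine ⟨fun x y => ?_⟩
    obtain ⟨g, hg⟩ := MulAction.exists_smul_eq M x y
    have hmem : MulAction.toPermHom M (M ⧸ H) g ∈ Subgroup.closure
        {MulAction.toPermHom M (M ⧸ H) m₀, MulAction.toPermHom M (M ⧸ H) m₁} := by
      have h1 : g ∈ Subgroup.closure {m₀, m₁} := by simp [hgen]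
      have h2 := Subgroup.mem_map_of_mem (MulAction.toPermHom M (M ⧸ H)) h1
      rwa [MonoidHom.map_closure, Set.image_pair] at h2
    exact ⟨⟨_, hmem⟩, hg⟩

end Dessin

/-! ### The two transitive copies of `S₄` acting on the faces of a cube -/

/-- The faces of the cube `[-1, 1]³`: the pair `(k, s)` is the face with outward unit normal
`s e_k`. -/
abbrev CubeFace : Type := Fin 3 × ℤˣ

/-- The outward unit normal of a face. -/
def CubeFace.normal (f : CubeFace) : Fin 3 → ℤ := Pi.single f.1 (f.2 : ℤ)

/-- The isometry `g` of the cube induces the permutation `π` of its faces.  The isometries of the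
cube are the integral orthogonal matrices. -/
def CubeFace.Induces (g : Matrix.orthogonalGroup (Fin 3) ℤ) (π : Perm CubeFace) : Prop :=
  ∀ f : CubeFace, g.1.mulVec f.normal = (π f).normal

/-- The vertices of one of the two regular tetrahedra inscribed in the cube `[-1, 1]³`, the other
one consisting of the opposite vertices. -/
def inscribedTetrahedron : Set (Fin 3 → ℤ) := {v | (∀ k, v k = 1 ∨ v k = -1) ∧ ∏ k, v k = 1}

theorem CubeFace.induces_one : CubeFace.Induces 1 1 := by
  intro f; simp

theorem CubeFace.Induces.mul {g h : Matrix.orthogonalGroup (Fin 3) ℤ} {π ρ : Perm CubeFace}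
    (hg : CubeFace.Induces g π) (hh : CubeFace.Induces h ρ) :
    CubeFace.Induces (g * h) (π * ρ) := by
  intro f
  have h1 : (g * h).1 = g.1 * h.1 := rfl
  rw [h1, ← Matrix.mulVec_mulVec, hh f, hg (ρ f), Perm.mul_apply]

theorem orthogonal_inv_mulVec (g : Matrix.orthogonalGroup (Fin 3) ℤ) (v : Fin 3 → ℤ) :
    (g⁻¹).1.mulVec (g.1.mulVec v) = v := by
  have h1 : (g⁻¹).1 * g.1 = 1 := congrArg Subtype.val (inv_mul_cancel g)
  rw [Matrix.mulVec_mulVec, h1, Matrix.one_mulVec]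

theorem CubeFace.Induces.inv {g : Matrix.orthogonalGroup (Fin 3) ℤ} {π : Perm CubeFace}
    (hg : CubeFace.Induces g π) : CubeFace.Induces g⁻¹ π⁻¹ := by
  intro f
  have h1 := hg (π⁻¹ f)
  have h2 : π (π⁻¹ f) = f := Equiv.apply_symm_apply π f
  rw [h2] at h1
  rw [← h1, orthogonal_inv_mulVec]

/-- The group `Q` of permutations of the faces of the cube induced by its rotations. -/
def cubeRotations : Subgroup (Perm CubeFace) where
  carrier := {π | ∃ g : Matrix.orthogonalGroup (Fin 3) ℤ, CubeFace.Induces g π ∧ g.1.det = 1}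
  one_mem' := ⟨1, CubeFace.induces_one, by simp⟩
  mul_mem' := by
    rintro π ρ ⟨g, hg, dg⟩ ⟨h, hh, dh⟩
    refine ⟨g * h, hg.mul hh, ?_⟩
    have h1 : (g * h).1 = g.1 * h.1 := rfl
    rw [h1, Matrix.det_mul, dg, dh, one_mul]
  inv_mem' := by
    rintro π ⟨g, hg, dg⟩
    refine ⟨g⁻¹, hg.inv, ?_⟩
    have h1 : (g⁻¹).1 * g.1 = 1 := congrArg Subtype.val (inv_mul_cancel g)
    have h2 := congrArg Matrix.det h1
    rwa [Matrix.det_mul, dg, mul_one, Matrix.det_one] at h2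

/-- The group `P` of permutations of the faces of the cube induced by those isometries of the cube
which preserve each of the two inscribed tetrahedra (preserving one of them is enough, the other
one being its image under the antipodal map). -/
def cubeTetrahedral : Subgroup (Perm CubeFace) where
  carrier := {π | ∃ g : Matrix.orthogonalGroup (Fin 3) ℤ, CubeFace.Induces g π ∧
    ∀ v, g.1.mulVec v ∈ inscribedTetrahedron ↔ v ∈ inscribedTetrahedron}
  one_mem' := ⟨1, CubeFace.induces_one, by simp⟩
  mul_mem' := by
    rintro π ρ ⟨g, hg, dg⟩ ⟨h, hh, dh⟩
    refine ⟨g * h, hg.mul hh, fun v => ?_⟩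
    have h1 : (g * h).1 = g.1 * h.1 := rfl
    rw [h1, ← Matrix.mulVec_mulVec, dg, dh]
  inv_mem' := by
    rintro π ⟨g, hg, dg⟩
    refine ⟨g⁻¹, hg.inv, fun v => ?_⟩
    have h1 := orthogonal_inv_mulVec g⁻¹ v
    rw [inv_inv] at h1
    rw [← dg, h1]

/-- The copy of `P` in `Sₙ` acting on six points `ι f` as `P` acts on the faces of the cube, and
fixing all the other points. -/
noncomputable def tetrahedralIn {n : ℕ} (ι : CubeFace ↪ Fin n) : Subgroup (Perm (Fin n)) :=
  cubeTetrahedral.map (Perm.viaEmbeddingHom ι)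

/-- The copy of `Q` in `Sₙ` acting on six points `ι f` as `Q` acts on the faces of the cube, and
fixing all the other points. -/
noncomputable def rotationsIn {n : ℕ} (ι : CubeFace ↪ Fin n) : Subgroup (Perm (Fin n)) :=
  cubeRotations.map (Perm.viaEmbeddingHom ι)

/-- The four subgroups `B × B`, `B × A`, `A × B`, `A × A` of `Sₙ × Sₙ`, where `A` and `B` are the
copies of `P` and `Q`. -/
noncomputable def cubeStabilizer {n : ℕ} (ι : CubeFace ↪ Fin n) :
    Fin 4 → Subgroup (Perm (Fin n) × Perm (Fin n)) :=
  ![(rotationsIn ι).prod (rotationsIn ι), (rotationsIn ι).prod (tetrahedralIn ι),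
    (tetrahedralIn ι).prod (rotationsIn ι), (tetrahedralIn ι).prod (tetrahedralIn ι)]

/-! ### Cycle lengths of uniform permutations -/

/-! Z-orientability of a coset dessin is a question about characters (`isZOrientable_ofCosets`). A
labelling of the faces amounts to a function on the cosets which `m₀` and `m₁` both negate, hence to
a character `M → ±1` that is `-1` at both generators and trivial on `H`. Twisting replaces `(m₀,
m₁)` with another cyclically consecutive pair from `m₀, m₁, m∞ = (m₀ m₁)⁻¹`.

The characters of `Sₙ × Sₙ` are the products of powers of the two coordinate signs. The isometries
of the cube are signed permutations of the axes, and the parity of the induced permutation of the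
faces is the product of the signs (`sign_toPerm`). Hence `P`, where this product is `1`, is even,
while `Q`, where the determinant is `1`, has odd elements. A coordinate sign is thus trivial on a
factor `A` but not on a factor `B`, which also separates the four subgroups up to conjugacy.

Take `x, y` odd and `z` even with `xyz = 1`, and `m₀ = (x, z)`, `m₁ = (y, x)`, so `m∞ = (z, y)`. On
`(m₀, m₁, m∞)` the first sign is `(-, -, +)`, the second `(+, -, -)` and their product `(-, +, -)`.
Each nontrivial character therefore orients exactly one of `D, D', D''`, and `tot` counts the
nontrivial characters trivial on `Hᵢ`: there are 0, 1, 1, 3. For `H₂` the only one is the first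
sign, which orients `D` itself; for `H₁` it is the second, which orients `D'`.

Everything else is common to the four dessins. The elements `x, y, z` come from an `n`-cycle and an
`(n-1)`-cycle (`exists_generators`): their nontrivial powers move at least 7 points, whereas
elements of `A` and `B` move at most 6. So no nontrivial power of `m₀, m₁, m∞` fixes a coset, and
the passport depends only on the orders of these elements and the index of `H`. Coprime orders make
the pairs generate `M`. The automorphism group is `N(H)/H`, and each factor of `H` is complemented
in its normaliser by the antipodal map and the symmetric group on the other `n-6` points. -/

theorem Multiset.lcm_replicate_of_ne_zero {k : ℕ} (hk : k ≠ 0) (o : ℕ) :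
    (Multiset.replicate k o).lcm = o := by
  obtain ⟨k, rfl⟩ := Nat.exists_eq_succ_of_ne_zero hk
  clear hk
  induction k with
  | zero => simp
  | succ k ih => rw [Multiset.replicate_succ, Multiset.lcm_cons, ih]; simp

theorem cycleLengths_eq_replicate {E : Type*} [Finite E] (σ : Perm E) (o : ℕ) (ho : 0 < o)
    (h : ∀ e : E, Nat.card {e' : E // toCycle σ e' = toCycle σ e} = o) :
    cycleLengths σ = Multiset.replicate (Nat.card E / o) o := by
  classical
  let _ : Fintype (CycleOf σ) := Fintype.ofFinite _
  have hf : ∀ v : CycleOf σ, Nat.card {e : E // toCycle σ e = v} = o := by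
    intro v
    obtain ⟨e, rfl⟩ := Quotient.exists_rep v
    exact h e
  have hcard : Nat.card E = Nat.card (CycleOf σ) * o := by
    rw [Nat.card_congr (Equiv.sigmaFiberEquiv (toCycle σ)).symm, Nat.card_sigma,
      Finset.sum_congr rfl fun v _ => hf v]
    simp [Nat.card_eq_fintype_card]
  have h1 : cycleLengths σ = Multiset.map (fun _ => o) (Finset.univ : Finset (CycleOf σ)).val := by
    unfold cycleLengths
    convert Multiset.map_congr rfl fun v _ => hf v
  rw [h1, Multiset.map_const', hcard, Nat.mul_div_cancel _ ho, Nat.card_eq_fintype_card]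
  rfl

theorem card_cycle_toPermHom {M X : Type*} [Group M] [MulAction M X] [Finite X] (g : M) (e : X) :
    Nat.card {e' : X // toCycle (MulAction.toPermHom M X g) e' =
      toCycle (MulAction.toPermHom M X g) e} = Function.minimalPeriod (fun x => g • x) e := by
  classical
  have : Fintype (MulAction.orbit (Subgroup.zpowers g) e) := Fintype.ofFinite _
  rw [MulAction.minimalPeriod_eq_card, ← Nat.card_eq_fintype_card]
  refine Nat.card_congr (Equiv.subtypeEquivRight fun e' => ?_)
  change Quotient.mk _ e' = Quotient.mk _ e ↔ _
  rw [Quotient.eq]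
  change Perm.SameCycle _ e' e ↔ _
  rw [Perm.sameCycle_comm]
  constructor
  · rintro ⟨i, hi⟩
    rw [← map_zpow] at hi
    exact ⟨⟨g ^ i, i, rfl⟩, hi⟩
  · rintro ⟨⟨_, i, rfl⟩, hi⟩
    refine ⟨i, ?_⟩
    rw [← map_zpow]
    exact hi

/-- All the cycles of an element of a group acting on a coset space have the same length, when no
nontrivial power of the element fixes a coset. -/
theorem cycleLengths_toPermHom {M : Type*} [Group M] [Finite M] (H : Subgroup M) (g : M)
    (hg : ∀ (k : ℕ) (x : M), x⁻¹ * g ^ k * x ∈ H → g ^ k = 1) :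
    cycleLengths (MulAction.toPermHom M (M ⧸ H) g) =
      Multiset.replicate (H.index / orderOf g) (orderOf g) := by
  refine cycleLengths_eq_replicate _ _ (orderOf_pos g) fun e => ?_
  rw [card_cycle_toPermHom]
  refine Nat.dvd_antisymm ?_ ?_
  · apply Function.IsPeriodicPt.minimalPeriod_dvd
    rw [Function.IsPeriodicPt, smul_iterate, pow_orderOf_eq_one]
    exact one_smul _ _
  -- If the cycle through `xH` has length `p`, then `g ^ p` fixes `xH`, so `x⁻¹ g ^ p x ∈ H` and the
  -- hypothesis gives `g ^ p = 1`.
  · rw [orderOf_dvd_iff_pow_eq_one]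
    have h1 := Function.isPeriodicPt_minimalPeriod (fun x => g • x) e
    rw [Function.IsPeriodicPt, smul_iterate] at h1
    obtain ⟨x, rfl⟩ := QuotientGroup.mk_surjective e
    refine hg _ x ?_
    have h2 := (QuotientGroup.eq (s := H)).1 (Eq.symm h1 :)
    simpa [mul_assoc] using h2

/-! ### Coset dessins: passport, orientability, monodromy and automorphisms -/

namespace Dessin

section Cosets

variable {M : Type*} [Group M] [Finite M] (H : Subgroup M) {m₀ m₁ : M}
  (hgen : Subgroup.closure {m₀, m₁} = ⊤)

theorem ofCosets_σinf : (ofCosets H m₀ m₁ hgen).σinf =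
    MulAction.toPermHom M (M ⧸ H) (m₀ * m₁)⁻¹ := by
  rw [map_inv, map_mul]; rfl

theorem passport_ofCosets
    (h₀ : ∀ (k : ℕ) (x : M), x⁻¹ * m₀ ^ k * x ∈ H → m₀ ^ k = 1)
    (h₁ : ∀ (k : ℕ) (x : M), x⁻¹ * m₁ ^ k * x ∈ H → m₁ ^ k = 1)
    (h₂ : ∀ (k : ℕ) (x : M), x⁻¹ * (m₀ * m₁)⁻¹ ^ k * x ∈ H → (m₀ * m₁)⁻¹ ^ k = 1) :
    (ofCosets H m₀ m₁ hgen).passport =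
      (Multiset.replicate (H.index / orderOf m₀) (orderOf m₀),
        Multiset.replicate (H.index / orderOf m₁) (orderOf m₁),
        Multiset.replicate (H.index / orderOf (m₀ * m₁)⁻¹) (orderOf (m₀ * m₁)⁻¹)) := by
  have e₀ := cycleLengths_toPermHom H _ h₀
  have e₁ := cycleLengths_toPermHom H _ h₁
  have e₂ := cycleLengths_toPermHom H _ h₂
  rw [← ofCosets_σinf H hgen] at e₂
  exact Prod.ext e₀ (Prod.ext e₁ e₂)

theorem isUniform_of_passport {E : Type*} (D : Dessin E) {a b c i j k : ℕ}
    (h : D.passport =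
      (Multiset.replicate i a, Multiset.replicate j b, Multiset.replicate k c)) :
    D.IsUniform := by
  -- Membership of `d` rules out the empty multiset, whose least common multiple is `1`.
  have key : ∀ i a d : ℕ, d ∈ Multiset.replicate i a → d = (Multiset.replicate i a).lcm := by
    intro i a d hd
    rw [Multiset.mem_replicate] at hd
    rw [Multiset.lcm_replicate_of_ne_zero hd.1, hd.2]
  unfold IsUniform type
  rw [h]
  exact ⟨key _ _, key _ _, key _ _⟩

theorem type_eq_of_passport_eq {E F : Type*} {D : Dessin E} {D' : Dessin F}
    (h : D.passport = D'.passport) : D.type = D'.type := by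
  unfold type; rw [h]

/-- A coset dessin is Z-orientable exactly when the group has a character with values `±1` which
takes the value `-1` at both generators and is trivial on the edge stabiliser. -/
theorem isZOrientable_ofCosets :
    (ofCosets H m₀ m₁ hgen).IsZOrientable ↔
      ∃ θ : M →* ℤˣ, θ m₀ = -1 ∧ θ m₁ = -1 ∧ H ≤ θ.ker := by
  set D := ofCosets H m₀ m₁ hgen with hD
  constructor
  · rintro ⟨label, hl⟩
    let ε : M ⧸ H → ℤˣ := fun e => label (toCycle D.σinf e)
    have hinf : ∀ e, ε ((m₀ * m₁) • e) = ε e := by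
      intro e
      refine congrArg label (Quotient.sound ⟨1, ?_⟩)
      rw [zpow_one, hD, ofCosets_σinf, map_inv, Perm.inv_eq_iff_eq]
      rfl
    have h0 : ∀ e, ε (m₀ • e) = -1 * ε e := by
      intro e
      have h1 : ε (m₀ • e) ≠ ε e := hl e
      rcases Int.units_eq_one_or (ε (m₀ • e)) with h2 | h2 <;>
      rcases Int.units_eq_one_or (ε e) with h3 | h3 <;> simp_all
    -- `m₀ m₁` preserves labels and `m₀` reverses them, so `m₁` reverses them too.
    have h1 : ∀ e, ε (m₁ • e) = -1 * ε e := by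
      intro e
      have h2 := h0 (m₁ • e)
      rw [← mul_smul, hinf] at h2
      rw [h2]; simp
    -- The elements that multiply `ε` by a constant form a subgroup containing the generators. The
    -- constant is the character sought; it is `1` on `H`, which fixes the base coset.
    have hex : ∀ g : M, ∃ s : ℤˣ, ∀ e, ε (g • e) = s * ε e := by
      intro g
      have hg : g ∈ Subgroup.closure {m₀, m₁} := hgen ▸ Subgroup.mem_top g
      induction hg using Subgroup.closure_induction with
      | mem x hx =>
        rcases hx with rfl | rfl
        exacts [⟨-1, h0⟩, ⟨-1, h1⟩]
      | one => exact ⟨1, by simp⟩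
      | mul x y _ _ ihx ihy =>
        obtain ⟨s, hs⟩ := ihx
        obtain ⟨t, ht⟩ := ihy
        exact ⟨s * t, fun e => by rw [mul_smul, hs, ht, mul_assoc]⟩
      | inv x _ ih =>
        obtain ⟨s, hs⟩ := ih
        refine ⟨s⁻¹, fun e => ?_⟩
        have := hs (x⁻¹ • e)
        rw [smul_inv_smul] at this
        rw [this, inv_mul_cancel_left]
    choose s hs using hex
    have huniq : ∀ g t, (∀ e, ε (g • e) = t * ε e) → s g = t := fun g t ht =>
      mul_right_cancel ((hs g ((1 : M) : M ⧸ H)).symm.trans (ht _))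
    refine ⟨⟨⟨s, huniq 1 1 (by simp)⟩, fun x y => huniq _ _ fun e => ?_⟩, huniq _ _ h0,
      huniq _ _ h1, fun h hh => huniq _ _ fun e => ?_⟩
    · rw [mul_smul, hs, hs, mul_assoc]
    · have h2 : h • ((1 : M) : M ⧸ H) = ((1 : M) : M ⧸ H) := by
        rw [MulAction.Quotient.smul_mk, QuotientGroup.eq]
        simpa using hh
      have h3 := hs h ((1 : M) : M ⧸ H)
      rw [h2] at h3
      have h4 : s h = 1 := by simpa using h3
      rw [hs, h4]
  · rintro ⟨θ, h0, h1, hH⟩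
    have hinf : ∀ g : M, θ g = θ ((m₀ * m₁) * g) := by
      intro g; simp [h0, h1]
    let ε : M ⧸ H → ℤˣ := Quotient.lift θ fun a b hab => by
      have h2 : θ (a⁻¹ * b) = 1 := hH (QuotientGroup.leftRel_apply.1 hab)
      rw [map_mul, map_inv, inv_mul_eq_one] at h2
      exact h2
    have hε : ∀ g : M, ε (g : M ⧸ H) = θ g := fun _ => rfl
    have hεinf : ∀ e, ε (D.σinf e) = ε e := by
      intro e
      obtain ⟨g, rfl⟩ := QuotientGroup.mk_surjective e
      rw [hD, ofCosets_σinf]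
      change ε (((m₀ * m₁)⁻¹ * g : M) : M ⧸ H) = _
      rw [hε, hε, map_mul, map_inv, map_mul, h0, h1]
      simp
    have hεz : ∀ (i : ℤ) e, ε ((D.σinf ^ i) e) = ε e := by
      intro i
      induction i using Int.induction_on with
      | zero => simp
      | succ i ih => intro e; rw [zpow_add_one, Perm.mul_apply, ih, hεinf]
      | pred i ih =>
        intro e
        rw [zpow_sub_one, Perm.mul_apply, ih, ← hεinf, Perm.inv_def, Equiv.apply_symm_apply]
    refine ⟨Quotient.lift ε fun a b hab => ?_, fun e => ?_⟩
    · obtain ⟨i, hi⟩ := hab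
      rw [← hi, hεz]
    · obtain ⟨g, rfl⟩ := QuotientGroup.mk_surjective e
      change θ (m₀ * g) ≠ θ g
      rw [map_mul, h0]
      rcases Int.units_eq_one_or (θ g) with h2 | h2 <;> rw [h2] <;> decide

theorem closure_twist {M : Type*} [Group M] {m₀ m₁ : M} :
    Subgroup.closure {m₁, (m₀ * m₁)⁻¹} = Subgroup.closure {m₀, m₁} := by
  apply le_antisymm <;> rw [Subgroup.closure_le]
  · have h0 : m₀ ∈ Subgroup.closure {m₀, m₁} := Subgroup.subset_closure (by simp)
    have h1 : m₁ ∈ Subgroup.closure {m₀, m₁} := Subgroup.subset_closure (by simp)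
    rintro x (rfl | rfl)
    exacts [h1, inv_mem (mul_mem h0 h1)]
  · have h1 : m₁ ∈ Subgroup.closure {m₁, (m₀ * m₁)⁻¹} := Subgroup.subset_closure (by simp)
    have h2 : (m₀ * m₁)⁻¹ ∈ Subgroup.closure {m₁, (m₀ * m₁)⁻¹} :=
      Subgroup.subset_closure (by simp)
    rintro x (rfl | rfl)
    · simpa using mul_mem (inv_mem h2) (inv_mem h1)
    · exact h1

theorem twist_ofCosets : (ofCosets H m₀ m₁ hgen).twist =
    ofCosets H m₁ (m₀ * m₁)⁻¹ (closure_twist.trans hgen) := by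
  have h := ofCosets_σinf H hgen
  unfold twist
  congr 1

/-- The twist-invariant orientability type of a coset dessin, in terms of the characters of the
group with values `±1`. -/
theorem tot_ofCosets (p : Fin 3 → Prop) [DecidablePred p]
    (hp : ∀ k, (∃ θ : M →* ℤˣ, θ (![m₀, m₁, (m₀ * m₁)⁻¹] k) = -1 ∧
      θ (![m₀, m₁, (m₀ * m₁)⁻¹] (k + 1)) = -1 ∧ H ≤ θ.ker) ↔ p k) :
    (ofCosets H m₀ m₁ hgen).tot = (Finset.univ.filter p).card := by
  rw [← Fintype.card_subtype, ← Nat.card_eq_fintype_card]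
  refine Nat.card_congr (Equiv.subtypeEquivRight fun k => Iff.trans ?_ (hp k))
  -- The second twist has generators `m∞, m₀`, which is why `k + 1` is read modulo 3.
  have h3 : (m₁ * (m₀ * m₁)⁻¹)⁻¹ = m₀ := by group
  fin_cases k
  · exact isZOrientable_ofCosets H hgen
  · change (ofCosets H m₀ m₁ hgen).twist.IsZOrientable ↔ _
    rw [twist_ofCosets, isZOrientable_ofCosets]
    rfl
  · change (ofCosets H m₀ m₁ hgen).twist.twist.IsZOrientable ↔ _
    rw [twist_ofCosets, twist_ofCosets, isZOrientable_ofCosets, h3]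
    rfl

theorem monodromyGroup_ofCosets :
    (ofCosets H m₀ m₁ hgen).monodromyGroup = (MulAction.toPermHom M (M ⧸ H)).range := by
  rw [MonoidHom.range_eq_map, ← hgen, MonoidHom.map_closure, Set.image_pair]
  rfl

theorem toPermHom_injective_of_normalCore {M : Type*} [Group M] (H : Subgroup M)
    (hcore : H.normalCore = ⊥) :
    Function.Injective (MulAction.toPermHom M (M ⧸ H)) := by
  rw [← MonoidHom.ker_eq_bot_iff, ← Subgroup.normalCore_eq_ker, hcore]

theorem nonempty_monodromyGroup_mulEquiv (hcore : H.normalCore = ⊥) :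
    Nonempty ((ofCosets H m₀ m₁ hgen).monodromyGroup ≃* M) :=
  ⟨(MulEquiv.subgroupCongr (monodromyGroup_ofCosets H hgen)).trans
    (MonoidHom.ofInjective (toPermHom_injective_of_normalCore H hcore)).symm⟩

/-- A trivial core makes the action faithful, so stabilisers can be computed in `M`, where that of
`gH` is the conjugate `gHg⁻¹`. -/
theorem nonempty_edgeStabilizer_mulEquiv (hcore : H.normalCore = ⊥) (e : M ⧸ H) :
    Nonempty ((ofCosets H m₀ m₁ hgen).edgeStabilizer e ≃* H) := by
  let φ : M ≃* (ofCosets H m₀ m₁ hgen).monodromyGroup :=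
    (MonoidHom.ofInjective (toPermHom_injective_of_normalCore H hcore)).trans
      (MulEquiv.subgroupCongr (monodromyGroup_ofCosets H hgen)).symm
  have hφ : ∀ g (x : M ⧸ H), φ g • x = g • x := fun _ _ => rfl
  have hmap : (MulAction.stabilizer M e).map φ.toMonoidHom =
      (ofCosets H m₀ m₁ hgen).edgeStabilizer e := by
    ext x
    obtain ⟨g, rfl⟩ := φ.surjective x
    constructor
    · rintro ⟨g', hg', h⟩
      obtain rfl := φ.injective h
      exact hg'
    · exact fun h => ⟨g, h, rfl⟩
  obtain ⟨g, rfl⟩ := QuotientGroup.mk_surjective e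
  have hst : MulAction.stabilizer M (g : M ⧸ H) = H.map (MulAut.conj g).toMonoidHom := by
    have h := MulAction.stabilizer_smul_eq_stabilizer_map_conj g ((1 : M) : M ⧸ H)
    rw [MulAction.stabilizer_quotient, MulAction.Quotient.smul_mk, smul_eq_mul, mul_one] at h
    exact h
  exact ⟨(MulEquiv.subgroupCongr hmap).symm.trans (((MulEquiv.subgroupCongr hst).trans
    (H.equivMapOfInjective _ (MulAut.conj g).injective).symm |>.symm.trans
      ((MulAction.stabilizer M (g : M ⧸ H)).equivMapOfInjective _ φ.injective)).symm)⟩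

/-- The automorphism group of a coset dessin is a complement of the edge stabiliser in its
normaliser. -/
theorem nonempty_automorphismGroup_mulEquiv {K : Type*} [Group K] (j : K →* M)
    (hnorm : ∀ k, j k ∈ Subgroup.normalizer (H : Set M)) (hinj : ∀ k, j k ∈ H → k = 1)
    (hsurj : ∀ g ∈ Subgroup.normalizer (H : Set M), ∃ k, ∃ h ∈ H, g = j k * h) :
    Nonempty ((ofCosets H m₀ m₁ hgen).automorphismGroup ≃* K) := by
  have hmem : ∀ α : Perm (M ⧸ H), α ∈ (ofCosets H m₀ m₁ hgen).automorphismGroup ↔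
      ∀ (g : M) x, α (g • x) = g • α x := by
    intro α
    have h1 : (ofCosets H m₀ m₁ hgen).automorphismGroup =
        Subgroup.centralizer ((MulAction.toPermHom M (M ⧸ H)).range : Set (Perm (M ⧸ H))) := by
      rw [← monodromyGroup_ofCosets H hgen]
      exact (Subgroup.centralizer_closure _).symm
    rw [h1, Subgroup.mem_centralizer_iff]
    constructor
    · intro h g x
      exact (DFunLike.congr_fun (h _ ⟨g, rfl⟩) x).symm
    · rintro h _ ⟨g, rfl⟩
      ext x
      exact (h g x).symm
  -- Right multiplication by a normalising element is well defined on left cosets; the inverse turns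
  -- it into a left action.
  let r : K → M ⧸ H → M ⧸ H := fun k =>
    Quotient.map' (fun m => m * (j k)⁻¹) fun a b hab => by
      rw [QuotientGroup.leftRel_apply] at hab ⊢
      have := (Subgroup.mem_normalizer_iff.1 (hnorm k) _).1 hab
      simpa [mul_assoc] using this
  have hr : ∀ k (m : M), r k (m : M ⧸ H) = ((m * (j k)⁻¹ : M) : M ⧸ H) := fun _ _ => rfl
  have hrmul : ∀ k l x, r k (r l x) = r (k * l) x := by
    intro k l x
    obtain ⟨m, rfl⟩ := QuotientGroup.mk_surjective x
    simp only [hr, map_mul, mul_inv_rev, mul_assoc]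
  have hrone : ∀ x, r 1 x = x := by
    intro x
    obtain ⟨m, rfl⟩ := QuotientGroup.mk_surjective x
    simp only [hr, map_one, inv_one, mul_one]
  let R : K →* (ofCosets H m₀ m₁ hgen).automorphismGroup := MonoidHom.mk' (fun k =>
    ⟨⟨r k, r k⁻¹, fun x => by rw [hrmul, inv_mul_cancel, hrone],
      fun x => by rw [hrmul, mul_inv_cancel, hrone]⟩, by
        rw [hmem]
        intro g x
        obtain ⟨m, rfl⟩ := QuotientGroup.mk_surjective x
        change ((g * m * (j k)⁻¹ : M) : M ⧸ H) = ((g * (m * (j k)⁻¹) : M) : M ⧸ H)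
        rw [mul_assoc]⟩)
    fun k l => Subtype.ext (Equiv.ext fun x => (hrmul k l x).symm)
  have hR : ∀ k x, (R k : Perm (M ⧸ H)) x = r k x := fun _ _ => rfl
  refine ⟨(MulEquiv.ofBijective R ⟨?_, ?_⟩).symm⟩
  · rw [injective_iff_map_eq_one]
    intro k hk
    have h1 : r k ((1 : M) : M ⧸ H) = ((1 : M) : M ⧸ H) := by rw [← hR, hk]; rfl
    rw [hr, QuotientGroup.eq] at h1
    exact hinj k (by simpa using h1)
  · rintro ⟨α, hα⟩
    have hα' := (hmem α).1 hα
    obtain ⟨g, hg⟩ := QuotientGroup.mk_surjective (α ((1 : M) : M ⧸ H))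
    have hmk : ∀ m : M, α (m : M ⧸ H) = ((m * g : M) : M ⧸ H) := by
      intro m
      have := hα' m ((1 : M) : M ⧸ H)
      rw [← hg] at this
      simpa [MulAction.Quotient.smul_mk] using this
    -- As `α` is injective and commutes with `M`, the cosets `H` and `α H = gH` have the same
    -- stabiliser, that is `H = gHg⁻¹`.
    have hgn : g ∈ Subgroup.normalizer (H : Set M) := by
      refine Subgroup.mem_normalizer_iff''.2 fun h => ?_
      have h1 := (hmk h).symm
      have h2 := (hmk 1).symm
      rw [one_mul] at h2
      have h3 : α (h : M ⧸ H) = α ((1 : M) : M ⧸ H) ↔ h ∈ H := by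
        rw [α.injective.eq_iff, QuotientGroup.eq]
        simp
      rw [← h3, ← h1, ← h2, QuotientGroup.eq, ← inv_mem_iff]
      simp [mul_assoc]
    obtain ⟨k, h, hh, hk⟩ := hsurj _ hgn
    refine ⟨k⁻¹, Subtype.ext (Equiv.ext fun x => ?_)⟩
    obtain ⟨m, rfl⟩ := QuotientGroup.mk_surjective x
    rw [hR, hr]
    change _ = α (m : M ⧸ H)
    rw [hmk, QuotientGroup.eq, hk]
    simpa using hh

end Cosets

end Dessin

/-! ### Generators of the symmetric group -/

/-- Every nontrivial power of the permutation moves at least seven points. -/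
def HasLargePowers {n : ℕ} (σ : Perm (Fin n)) : Prop :=
  ∀ k : ℕ, σ ^ k = 1 ∨ 7 ≤ (σ ^ k).support.card

theorem HasLargePowers.pow {n : ℕ} {σ : Perm (Fin n)} (h : HasLargePowers σ) (i : ℕ) :
    HasLargePowers (σ ^ i) := by
  intro k
  rw [← pow_mul]
  exact h _

theorem HasLargePowers.inv {n : ℕ} {σ : Perm (Fin n)} (h : HasLargePowers σ) :
    HasLargePowers σ⁻¹ := by
  intro k
  rw [inv_pow, inv_eq_one, Perm.support_inv]
  exact h k

theorem Equiv.Perm.IsCycle.hasLargePowers {n : ℕ} {σ : Perm (Fin n)} (h : σ.IsCycle)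
    (h7 : 7 ≤ σ.support.card) : HasLargePowers σ := by
  intro k
  by_cases hk : orderOf σ ∣ k
  · exact Or.inl (orderOf_dvd_iff_pow_eq_one.1 hk)
  · rw [h.support_pow_eq_iff.2 hk]
    exact Or.inr h7

/-- Multiplying an `n`-cycle by a transposition of two consecutive points gives an `(n-1)`-cycle.
One of the two lengths is even; since `s² = 1`, either cycle is `s` times the other, so `c` can be
taken to be the even one. The bound `n ≥ 8` makes both lengths at least 7. -/
theorem exists_cycle_mul_swap (n : ℕ) (hn : 8 ≤ n) :
    ∃ c d s : Perm (Fin n), c.IsCycle ∧ d.IsCycle ∧ s * s = 1 ∧ d = s * c ∧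
      Even c.support.card ∧ Odd d.support.card ∧ 7 ≤ c.support.card ∧ 7 ≤ d.support.card ∧
      Nat.Coprime c.support.card d.support.card ∧ Subgroup.closure {c, s} = ⊤ := by
  obtain ⟨m, rfl⟩ : ∃ m, n = m + 2 := ⟨n - 2, by omega⟩
  set f := finRotate (m + 2) with hf
  have hfc : f.IsCycle := isCycle_finRotate
  have hfs : f.support = Finset.univ := support_finRotate
  have h0 : f 0 = 1 := by simp [hf]
  have h1 : f (f 0) ≠ 0 := by
    rw [h0, hf, finRotate_apply]
    intro h
    have := congrArg Fin.val h
    rw [Fin.val_add_one_of_lt (by rw [Fin.lt_def]; simp; omega)] at this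
    simp at this
  have h0' : f 0 ≠ 0 := by rw [h0]; simp
  set s := swap 0 (f 0) with hs
  have hss : s * s = 1 := swap_mul_self _ _
  have hgc : (s * f).IsCycle := hfc.swap_mul h0' h1
  have hgs : (s * f).support.card = m + 1 := by
    rw [Perm.support_swap_mul_eq f 0 h1, hfs, Finset.card_sdiff_of_subset (by simp)]
    simp
  have hfn : f.support.card = m + 2 := by rw [hfs]; simp
  have hcl : Subgroup.closure {f, s} = ⊤ := Perm.closure_cycle_adjacent_swap hfc hfs 0
  rcases Nat.even_or_odd m with he | ho
  · refine ⟨f, s * f, s, hfc, hgc, hss, rfl, ?_, ?_, ?_, ?_, ?_, hcl⟩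
    · rw [hfn]; exact he.add even_two
    · rw [hgs]; exact he.add_one
    · omega
    · omega
    · rw [hfn, hgs]
      exact Nat.coprime_self_add_left.2 (Nat.coprime_one_left _)
  · refine ⟨s * f, f, s, hgc, hfc, hss, ?_, ?_, ?_, ?_, ?_, ?_, ?_⟩
    · rw [← mul_assoc, hss, one_mul]
    · rw [hgs]; exact ho.add_one
    · rw [hfn]; exact ho.add_even even_two
    · omega
    · omega
    · rw [hfn, hgs]
      exact Nat.coprime_self_add_right.2 (Nat.coprime_one_right _)
    · rw [eq_top_iff, ← hcl, Subgroup.closure_le]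
      have ha : s * f ∈ Subgroup.closure {s * f, s} := Subgroup.subset_closure (by simp)
      have hb : s ∈ Subgroup.closure {s * f, s} := Subgroup.subset_closure (by simp)
      rintro x (rfl | rfl)
      · have := mul_mem hb ha
        rwa [← mul_assoc, hss, one_mul] at this
      · exact hb

/-- Take `x = scs` and `y = c`, so that `xy = (sc)² = d²` and `z = d⁻²`. The cycle `d` has odd
length, so it is a power of `d²`; hence `x, y` generate `c`, `d` and `s = dc⁻¹`. The orders are the
coprime lengths of `c` and `d`. -/
theorem exists_generators (n : ℕ) (hn : 8 ≤ n) :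
    ∃ x y z : Perm (Fin n), z = (x * y)⁻¹ ∧ Perm.sign x = -1 ∧ Perm.sign y = -1 ∧
      Perm.sign z = 1 ∧ Subgroup.closure {x, y} = ⊤ ∧ HasLargePowers x ∧ HasLargePowers y ∧
      HasLargePowers z ∧ (orderOf x).Coprime (orderOf z) ∧ (orderOf y).Coprime (orderOf z) := by
  obtain ⟨c, d, s, hc, hd, hs, hdc, hec, hod, hc7, hd7, hcop, hcl⟩ := exists_cycle_mul_swap n hn
  have hsinv : s⁻¹ = s := inv_eq_of_mul_eq_one_left hs
  have hx : s * c * s = s * c * s⁻¹ := by rw [hsinv]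
  have hxc : (s * c * s).IsCycle := hx ▸ hc.conj
  have hxn : (s * c * s).support.card = c.support.card := by
    rw [hx, Perm.card_support_conj]
  have hxy : s * c * s * c = d ^ 2 := by rw [hdc, pow_two, mul_assoc]
  have hsc : Perm.sign c = -1 := by rw [hc.sign, hec.neg_one_pow]
  have hsx : Perm.sign (s * c * s) = -1 := by
    rw [hxc.sign, hxn, hec.neg_one_pow]
  have hodd : Odd (orderOf d) := by rw [hd.orderOf]; exact hod
  have hord : orderOf (d ^ 2)⁻¹ = d.support.card := by
    rw [orderOf_inv, Nat.Coprime.orderOf_pow (Nat.coprime_two_right.2 hodd), hd.orderOf]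
  refine ⟨s * c * s, c, (d ^ 2)⁻¹, by rw [hxy], hsx, hsc, ?_, ?_,
    hxc.hasLargePowers (hxn ▸ hc7), hc.hasLargePowers hc7, ((hd.hasLargePowers hd7).pow 2).inv,
    ?_, ?_⟩
  · rw [map_inv, ← hxy, map_mul, hsx, hsc]; simp
  · rw [eq_top_iff, ← hcl, Subgroup.closure_le]
    have h0 : s * c * s ∈ Subgroup.closure {s * c * s, c} := Subgroup.subset_closure (by simp)
    have h1 : c ∈ Subgroup.closure {s * c * s, c} := Subgroup.subset_closure (by simp)
    have h2 : d ∈ Subgroup.closure {s * c * s, c} := by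
      -- With `o` the odd order of `d`, `(d²) ^ ((o + 1) / 2) = d ^ (o + 1) = d`.
      have h3 := pow_mem (hxy ▸ mul_mem h0 h1) ((orderOf d + 1) / 2)
      rwa [← pow_mul, Nat.mul_div_cancel' (even_iff_two_dvd.1 hodd.add_one), pow_succ,
        pow_orderOf_eq_one, one_mul] at h3
    rintro x (rfl | rfl)
    · exact h1
    · have h3 := mul_mem h2 (inv_mem h1)
      rwa [hdc, mul_inv_cancel_right] at h3
  · rw [hord, hxc.orderOf, hxn]; exact hcop
  · rw [hord, hc.orderOf]; exact hcop

/-- If the coordinates of a pair have coprime orders, then a group containing the pair contains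
both coordinates. -/
theorem mk_one_mem_of_coprime {G G' : Type*} [Group G] [Group G'] {T : Subgroup (G × G')}
    {a : G} {b : G'} (h : (a, b) ∈ T) (hab : (orderOf a).Coprime (orderOf b)) :
    (a, 1) ∈ T ∧ (1, b) ∈ T := by
  obtain ⟨k, hka, hkb⟩ := Nat.chineseRemainder hab 1 0
  have ha : a ^ k = a := by
    have := (pow_eq_pow_iff_modEq (x := a)).2 hka
    rwa [pow_one] at this
  have hb : b ^ k = 1 := by
    have := (pow_eq_pow_iff_modEq (x := b)).2 hkb
    rwa [pow_zero] at this
  have h1 : (a, (1 : G')) ∈ T := by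
    have h2 := pow_mem h k
    rwa [Prod.pow_mk, ha, hb] at h2
  refine ⟨h1, ?_⟩
  have h2 := mul_mem (inv_mem h1) h
  simpa using h2

theorem eq_top_of_mk_one_mem {G : Type*} [Group G] {T : Subgroup (G × G)} {x y z : G}
    (hz : z = (x * y)⁻¹) (hxy : Subgroup.closure {x, y} = ⊤) (h1 : (x, (1 : G)) ∈ T)
    (h2 : (z, (1 : G)) ∈ T) (h3 : ((1 : G), y) ∈ T) (h4 : ((1 : G), z) ∈ T) : T = ⊤ := by
  have ha : T.comap (MonoidHom.inl G G) = ⊤ := by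
    rw [eq_top_iff, ← hxy, Subgroup.closure_le]
    rintro u (rfl | rfl)
    · exact h1
    · have := mul_mem (inv_mem h1) (inv_mem h2)
      simpa [hz] using this
  have hb : T.comap (MonoidHom.inr G G) = ⊤ := by
    rw [eq_top_iff, ← hxy, Subgroup.closure_le]
    rintro u (rfl | rfl)
    · have := mul_mem (inv_mem h4) (inv_mem h3)
      simpa [hz] using this
    · exact h3
  rw [eq_top_iff]
  rintro ⟨a, b⟩ -
  have h5 : (a, (1 : G)) ∈ T := (ha ▸ Subgroup.mem_top a : a ∈ T.comap (MonoidHom.inl G G))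
  have h6 : ((1 : G), b) ∈ T := (hb ▸ Subgroup.mem_top b : b ∈ T.comap (MonoidHom.inr G G))
  simpa using mul_mem h5 h6

/-- The entries of `(y, x)` need not have coprime orders, but the inverse of the product of the
generators is `(z, y)`. This pair and `(x, z)` split into their coordinates, which generate each
factor. -/
theorem closure_pair_eq_top {G : Type*} [Group G] {x y z : G} (hz : z = (x * y)⁻¹)
    (hxy : Subgroup.closure {x, y} = ⊤) (hxz : (orderOf x).Coprime (orderOf z))
    (hyz : (orderOf y).Coprime (orderOf z)) :
    Subgroup.closure {((x, z) : G × G), (y, x)} = ⊤ := by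
  set T := Subgroup.closure {((x, z) : G × G), (y, x)} with hT
  have h0 : (x, z) ∈ T := Subgroup.subset_closure (by simp)
  have h1 : (y, x) ∈ T := Subgroup.subset_closure (by simp)
  have h2 : (z, y) ∈ T := by
    have := inv_mem (mul_mem h0 h1)
    convert this using 1
    simp [hz, mul_assoc]
  obtain ⟨h3, h4⟩ := mk_one_mem_of_coprime h0 hxz
  obtain ⟨h5, h6⟩ := mk_one_mem_of_coprime h2 hyz.symm
  exact eq_top_of_mk_one_mem hz hxy h3 h5 h6 h4

/-! ### Characters of the symmetric group -/

theorem Equiv.Perm.hom_eq_one_or_sign {α : Type*} [DecidableEq α] [Fintype α]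
    (θ : Perm α →* ℤˣ) : θ = 1 ∨ θ = Perm.sign := by
  by_cases h : Function.Surjective θ
  · exact Or.inr (Perm.eq_sign_of_surjective_hom h)
  · refine Or.inl (MonoidHom.ext fun g => ?_)
    by_contra hg
    refine h fun s => ?_
    rcases Int.units_eq_one_or s with rfl | rfl
    · exact ⟨1, map_one θ⟩
    · exact ⟨g, (Int.units_eq_one_or _).resolve_left hg⟩

/-! ### Signed permutations of the coordinate axes -/

/-- The group of signed permutations of the three coordinate axes. -/
abbrev SignedPerm : Type := (Fin 3 → ℤˣ) ⋊[mulAutArrow] Perm (Fin 3)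

namespace SignedPerm

theorem mul_left_apply (v w : SignedPerm) (k : Fin 3) :
    (v * w).left k = v.left k * w.left (v.right⁻¹ k) := rfl

/-- The action of the signed permutations on the faces of the cube. -/
def toPerm : SignedPerm →* Perm CubeFace where
  toFun w :=
    { toFun := fun f => (w.right f.1, w.left (w.right f.1) * f.2)
      invFun := fun f => (w.right⁻¹ f.1, w.left f.1 * f.2)
      left_inv := fun f => by ext <;> simp [← mul_assoc]
      right_inv := fun f => by ext <;> simp [← mul_assoc] }
  map_one' := by ext f <;> simp
  map_mul' v w := by
    refine Equiv.ext fun f => Prod.ext ?_ ?_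
    · simp
    · simp [mul_left_apply, mul_assoc, -SemidirectProduct.mul_left]

theorem toPerm_apply (w : SignedPerm) (f : CubeFace) :
    toPerm w f = (w.right f.1, w.left (w.right f.1) * f.2) := rfl

theorem toPerm_injective : Function.Injective toPerm := by
  rw [injective_iff_map_eq_one]
  intro w hw
  have h : ∀ f : CubeFace, (w.right f.1, w.left (w.right f.1) * f.2) = f := fun f =>
    DFunLike.congr_fun hw f
  have h1 : w.right = 1 := Equiv.ext fun k => congrArg Prod.fst (h (k, 1))
  refine SemidirectProduct.ext (funext fun k => ?_) h1
  have h2 := congrArg Prod.snd (h (k, 1))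
  simpa [h1] using h2

/-- The change of all the signs by `s`: the identity or the antipodal map. -/
def scalar : ℤˣ →* SignedPerm := SemidirectProduct.inl.comp (Pi.constMonoidHom (Fin 3) ℤˣ)

theorem scalar_mul (s : ℤˣ) (w : SignedPerm) : scalar s * w = w * scalar s := by
  refine SemidirectProduct.ext (funext fun k => ?_) ?_
  · rw [mul_left_apply, mul_left_apply, mul_comm]; rfl
  · simp [scalar]

theorem toPerm_scalar (s : ℤˣ) (f : CubeFace) : toPerm (scalar s) f = (f.1, s * f.2) := rfl

/-- The rotation by half a turn about the `k`-th axis. -/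
def halfTurn (k : Fin 3) : SignedPerm := SemidirectProduct.inl fun i => if i = k then 1 else -1

theorem toPerm_halfTurn (k : Fin 3) (f : CubeFace) :
    toPerm (halfTurn k) f = (f.1, (if f.1 = k then 1 else -1) * f.2) := rfl

/-- A permutation commuting with the antipodal map permutes the three pairs of opposite faces, and
is determined by the images of the three positive faces. -/
theorem mem_range_toPerm {π : Perm CubeFace}
    (h : ∀ f, π (toPerm (scalar (-1)) f) = toPerm (scalar (-1)) (π f)) : π ∈ toPerm.range := by
  have h1 : ∀ k (s : ℤˣ), π (k, s) = ((π (k, 1)).1, (π (k, 1)).2 * s) := by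
    intro k s
    rcases Int.units_eq_one_or s with rfl | rfl
    · simp
    · have := h (k, 1)
      rw [toPerm_scalar, toPerm_scalar] at this
      rw [mul_comm]
      simpa using this
  have hinj : Function.Injective fun k => (π (k, 1)).1 := by
    intro k l hkl
    have : π (k, (π (k, 1)).2) = π (l, (π (l, 1)).2) := by
      rw [h1 k, h1 l, ← sq, ← sq, Int.units_sq, Int.units_sq]
      exact Prod.ext hkl rfl
    exact congrArg Prod.fst (π.injective this)
  let ρ : Perm (Fin 3) := Equiv.ofBijective _ (Finite.injective_iff_bijective.1 hinj)
  have hρ : ∀ k, ρ k = (π (k, 1)).1 := fun _ => rfl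
  refine ⟨⟨fun k => (π (ρ⁻¹ k, 1)).2, ρ⟩, Equiv.ext fun f => ?_⟩
  rw [toPerm_apply, h1 f.1 f.2]
  have h2 : ρ⁻¹ (π (f.1, 1)).1 = f.1 := by rw [← hρ]; simp
  change ((π (f.1, 1)).1, (π (ρ⁻¹ (π (f.1, 1)).1, 1)).2 * f.2) = _
  rw [h2]

/-- The product of the signs of a signed permutation. -/
def signProd : SignedPerm →* ℤˣ where
  toFun w := ∏ k, w.left k
  map_one' := by simp
  map_mul' v w := by
    simp_rw [mul_left_apply]
    rw [Finset.prod_mul_distrib, Equiv.prod_comp v.right⁻¹ w.left]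

theorem signProd_apply (w : SignedPerm) : signProd w = ∏ k, w.left k := rfl

/-- The determinant of a signed permutation. -/
def det : SignedPerm →* ℤˣ := Perm.sign.comp SemidirectProduct.rightHom * signProd

theorem det_apply (w : SignedPerm) : det w = Perm.sign w.right * ∏ k, w.left k := by
  rw [det, MonoidHom.mul_apply, signProd_apply]; rfl

/-- The matrix of a signed permutation. -/
def toMatrix (w : SignedPerm) : Matrix (Fin 3) (Fin 3) ℤ :=
  Matrix.of fun i j => if i = w.right j then (w.left i : ℤ) else 0

theorem toMatrix_mulVec (w : SignedPerm) (v : Fin 3 → ℤ) (j : Fin 3) :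
    w.toMatrix.mulVec v (w.right j) = w.left (w.right j) * v j := by
  simp [toMatrix, Matrix.mulVec, dotProduct]

theorem toMatrix_mulVec_apply (w : SignedPerm) (v : Fin 3 → ℤ) (i : Fin 3) :
    w.toMatrix.mulVec v i = w.left i * v (w.right⁻¹ i) := by
  have := w.toMatrix_mulVec v (w.right⁻¹ i)
  simpa using this

theorem toMatrix_mulVec_normal (w : SignedPerm) (f : CubeFace) :
    w.toMatrix.mulVec f.normal = (toPerm w f).normal := by
  funext i
  rw [toMatrix_mulVec_apply, toPerm_apply]
  simp only [CubeFace.normal]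
  by_cases h : i = w.right f.1
  · subst h; simp
  · have h2 : w.right⁻¹ i ≠ f.1 := fun h3 => h (by rw [← h3]; simp)
    rw [Pi.single_eq_of_ne h2, Pi.single_eq_of_ne h, mul_zero]

theorem toMatrix_mul_transpose (w : SignedPerm) : w.toMatrix * w.toMatrix.transpose = 1 := by
  ext i k
  rw [Matrix.mul_apply]
  have h : ∀ j, w.toMatrix i j * w.toMatrix.transpose j k =
      if j = w.right⁻¹ i then (if i = k then 1 else 0) else 0 := by
    intro j
    simp only [toMatrix, Matrix.transpose_apply, Matrix.of_apply]
    by_cases h1 : i = w.right j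
    · subst h1
      by_cases h2 : w.right j = k
      · subst h2
        simp
      · simp [h2, Ne.symm h2]
    · have h2 : j ≠ w.right⁻¹ i := fun h3 => h1 (by rw [h3]; simp)
      rw [if_neg h1, if_neg h2, zero_mul]
  rw [Finset.sum_congr rfl fun j _ => h j]
  simp [Matrix.one_apply]

/-- The matrix of a signed permutation as an isometry of the cube. -/
def toOrthogonal (w : SignedPerm) : Matrix.orthogonalGroup (Fin 3) ℤ :=
  ⟨w.toMatrix, (Matrix.mem_orthogonalGroup_iff _ _).2 w.toMatrix_mul_transpose⟩

theorem det_toMatrix (w : SignedPerm) : w.toMatrix.det = (det w : ℤ) := by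
  have h : w.toMatrix = Matrix.diagonal (fun i => (w.left i : ℤ)) * Perm.permMatrix ℤ w.right⁻¹ := by
    ext i j
    rw [Matrix.diagonal_mul]
    by_cases h1 : i = w.right j
    · simp [toMatrix, h1, Perm.permMatrix, PEquiv.toMatrix_apply]
    · have h2 : w.right⁻¹ i ≠ j := fun h3 => h1 (by rw [← h3]; simp)
      have h3 : (Equiv.symm w.right) i ≠ j := h2
      simp [toMatrix, h1, h3, Perm.permMatrix, PEquiv.toMatrix_apply]
  rw [h, Matrix.det_mul, Matrix.det_diagonal, Matrix.det_permutation, det_apply]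
  simp [mul_comm]

end SignedPerm

/-! ### The groups of the cube as kernels of characters -/

open SignedPerm

theorem CubeFace.normal_injective : Function.Injective CubeFace.normal := by
  decide

theorem CubeFace.normal_toPerm_neg (f : CubeFace) :
    (toPerm (scalar (-1)) f).normal = -f.normal := by
  rw [toPerm_scalar]
  simp [CubeFace.normal, Pi.single_neg]

/-- By linearity of `g`, `π` commutes with the antipodal map, so it comes from a signed permutation;
the matrices agree because they agree on the basis vectors. -/
theorem CubeFace.Induces.exists_signedPerm {g : Matrix.orthogonalGroup (Fin 3) ℤ}
    {π : Perm CubeFace} (h : CubeFace.Induces g π) :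
    ∃ w : SignedPerm, π = toPerm w ∧ g.1 = w.toMatrix := by
  obtain ⟨w, rfl⟩ : π ∈ toPerm.range := by
    refine mem_range_toPerm fun f => CubeFace.normal_injective ?_
    rw [← h, CubeFace.normal_toPerm_neg, Matrix.mulVec_neg, h, CubeFace.normal_toPerm_neg]
  refine ⟨w, rfl, ?_⟩
  refine Matrix.ext_of_mulVec_single fun k => ?_
  have h1 := (h (k, 1)).trans (w.toMatrix_mulVec_normal (k, 1)).symm
  simpa [CubeFace.normal] using h1

theorem cubeRotations_eq : cubeRotations = SignedPerm.det.ker.map toPerm := by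
  ext π
  constructor
  · rintro ⟨g, hg, hd⟩
    obtain ⟨w, rfl, hw⟩ := hg.exists_signedPerm
    refine ⟨w, ?_, rfl⟩
    rw [hw, det_toMatrix] at hd
    exact Units.ext hd
  · rintro ⟨w, hw, rfl⟩
    refine ⟨w.toOrthogonal, w.toMatrix_mulVec_normal, ?_⟩
    change w.toMatrix.det = 1
    rw [det_toMatrix, MonoidHom.mem_ker.1 hw]
    rfl

theorem SignedPerm.toMatrix_mulVec_mem_inscribedTetrahedron {w : SignedPerm}
    (hw : signProd w = 1) {v : Fin 3 → ℤ} :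
    w.toMatrix.mulVec v ∈ inscribedTetrahedron ↔ v ∈ inscribedTetrahedron := by
  have h1 : ∏ k, w.toMatrix.mulVec v k = ∏ k, v k := by
    simp_rw [toMatrix_mulVec_apply]
    rw [Finset.prod_mul_distrib, Equiv.prod_comp w.right⁻¹ v]
    have : ∏ k, (w.left k : ℤ) = 1 := by
      rw [← Units.coe_prod, ← signProd_apply, hw]; rfl
    rw [this, one_mul]
  have h2 : (∀ k, w.toMatrix.mulVec v k = 1 ∨ w.toMatrix.mulVec v k = -1) ↔
      ∀ k, v k = 1 ∨ v k = -1 := by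
    rw [← w.right.forall_congr_right]
    refine forall_congr' fun k => ?_
    rw [toMatrix_mulVec]
    rcases Int.units_eq_one_or (w.left (w.right k)) with h | h <;> rw [h] <;> simp; omega
  exact and_congr h2 (by rw [h1])

theorem cubeTetrahedral_eq : cubeTetrahedral = signProd.ker.map toPerm := by
  ext π
  constructor
  · rintro ⟨g, hg, hd⟩
    obtain ⟨w, rfl, hw⟩ := hg.exists_signedPerm
    refine ⟨w, ?_, rfl⟩
    -- The image of the vertex `(1, 1, 1)` is the vector of signs of `w`, so its product is
    -- `signProd w`.
    have h1 := ((hd fun _ => 1).2 ⟨by simp, by simp⟩).2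
    simp_rw [hw, toMatrix_mulVec_apply, mul_one] at h1
    change signProd w = 1
    rw [signProd_apply]
    exact Units.ext (by rw [Units.coe_prod, h1]; rfl)
  · rintro ⟨w, hw, rfl⟩
    exact ⟨w.toOrthogonal, w.toMatrix_mulVec_normal,
      fun v => toMatrix_mulVec_mem_inscribedTetrahedron hw⟩

/-! ### Both groups of the cube are isomorphic to `S₄` -/

/-- The vertices of the inscribed tetrahedron, as vectors of signs. -/
abbrev TetrahedronVertex : Type := {v : Fin 3 → ℤˣ // ∏ k, v k = 1}

/-- The action of the tetrahedral group on the vertices of the tetrahedron. -/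
def SignedPerm.vertexHom : signProd.ker →* Perm TetrahedronVertex :=
  letI : MulAction signProd.ker TetrahedronVertex :=
    { smul := fun w v => ⟨w.1.left * fun k => v.1 (w.1.right⁻¹ k), by
        have h : signProd w.1 = 1 := w.2
        rw [signProd_apply] at h
        simp_rw [Pi.mul_apply]
        rw [Finset.prod_mul_distrib, h, Equiv.prod_comp w.1.right⁻¹ v.1, v.2, mul_one]⟩
      one_smul := fun v => Subtype.ext (funext fun k => by
        change (1 : SignedPerm).left k * v.1 ((1 : SignedPerm).right⁻¹ k) = v.1 k
        simp)
      mul_smul := fun w w' v => Subtype.ext (funext fun k => by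
        change (w.1 * w'.1).left k * v.1 ((w.1 * w'.1).right⁻¹ k) =
          w.1.left k * (w'.1.left (w.1.right⁻¹ k) * v.1 (w'.1.right⁻¹ (w.1.right⁻¹ k)))
        rw [mul_left_apply, mul_assoc, SemidirectProduct.mul_right, mul_inv_rev]
        rfl) }
  MulAction.toPermHom _ _

theorem SignedPerm.vertexHom_apply (w : signProd.ker) (v : TetrahedronVertex) (k : Fin 3) :
    (vertexHom w v).1 k = w.1.left k * v.1 (w.1.right⁻¹ k) := rfl

theorem SignedPerm.vertexHom_injective : Function.Injective vertexHom := by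
  rw [injective_iff_map_eq_one]
  rintro ⟨w, hw⟩ h
  have h1 : ∀ (v : TetrahedronVertex) k, w.left k * v.1 (w.right⁻¹ k) = v.1 k := by
    intro v k
    rw [← vertexHom_apply ⟨w, hw⟩, h]
    rfl
  have h2 : w.left = 1 := funext fun k => by simpa using h1 ⟨1, by simp⟩ k
  have h3 : ∀ ρ : Perm (Fin 3), (∀ (v : TetrahedronVertex) k, v.1 (ρ k) = v.1 k) → ρ = 1 := by
    decide
  have h4 := h3 w.right⁻¹ fun v k => by simpa [h2] using h1 v k
  exact Subtype.ext (SemidirectProduct.ext h2 (inv_eq_one.1 h4))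

/-- The action on the four vertices of the tetrahedron is faithful, and both groups have order `4 ·
6 = 24`. -/
theorem SignedPerm.nonempty_ker_signProd_mulEquiv : Nonempty (signProd.ker ≃* Perm (Fin 4)) := by
  have hV : Fintype.card TetrahedronVertex = Fintype.card (Fin 4) := by decide
  let e : signProd.ker ≃ TetrahedronVertex × Perm (Fin 3) :=
    { toFun := fun w => (⟨w.1.left, (signProd_apply w.1).symm.trans w.2⟩, w.1.right)
      invFun := fun p => ⟨⟨p.1.1, p.2⟩, (signProd_apply _).trans p.1.2⟩
      left_inv := fun w => rfl
      right_inv := fun p => rfl }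
  have hcard : Nat.card signProd.ker = Nat.card (Perm TetrahedronVertex) := by
    rw [Nat.card_congr e, Nat.card_prod, Nat.card_perm, Nat.card_perm,
      Nat.card_eq_fintype_card, hV]
    simp [Nat.factorial]
  have : Finite signProd.ker := Finite.of_equiv _ e.symm
  exact ⟨(MulEquiv.ofBijective vertexHom
    ((Nat.bijective_iff_injective_and_card _).2 ⟨vertexHom_injective, hcard⟩)).trans
      (Equiv.permCongrHom (Fintype.equivOfCardEq hV))⟩

/-- The involution of the group of signed permutations multiplying each signed permutation by the
sign of the underlying permutation; it exchanges the two groups of the cube. -/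
def SignedPerm.signTwist : SignedPerm ≃* SignedPerm where
  toFun w := scalar (Perm.sign w.right) * w
  invFun w := scalar (Perm.sign w.right) * w
  left_inv w := by
    have : (scalar (Perm.sign w.right) * w).right = w.right := by simp [scalar]
    beta_reduce
    rw [this, ← mul_assoc, ← map_mul, ← sq, Int.units_sq, map_one, one_mul]
  right_inv w := by
    have : (scalar (Perm.sign w.right) * w).right = w.right := by simp [scalar]
    beta_reduce
    rw [this, ← mul_assoc, ← map_mul, ← sq, Int.units_sq, map_one, one_mul]
  map_mul' v w := by
    rw [SemidirectProduct.mul_right, map_mul, map_mul, mul_assoc, ← mul_assoc _ v w, scalar_mul _ v]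
    simp only [mul_assoc]

theorem SignedPerm.signProd_scalar (s : ℤˣ) : signProd (scalar s) = s := by
  rw [signProd_apply]
  revert s; decide

theorem SignedPerm.det_scalar (s : ℤˣ) : det (scalar s) = s := by
  rw [det_apply]
  revert s; decide

theorem SignedPerm.signProd_halfTurn (k : Fin 3) : signProd (halfTurn k) = 1 := by
  rw [signProd_apply]
  revert k; decide

theorem SignedPerm.det_halfTurn (k : Fin 3) : det (halfTurn k) = 1 := by
  rw [det_apply]
  revert k; decide

/-- In odd dimension the scalar `s` has sign product `s³ = s`, so the twist carries `det` to
`signProd`. -/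
theorem SignedPerm.map_ker_det : det.ker.map signTwist.toMonoidHom = signProd.ker := by
  have h : ∀ w, signProd (signTwist w) = det w := by
    intro w
    change signProd (scalar (Perm.sign w.right) * w) = _
    rw [map_mul, signProd_scalar, det_apply, signProd_apply]
  ext w
  obtain ⟨v, rfl⟩ := signTwist.surjective w
  rw [MonoidHom.mem_ker, h]
  constructor
  · rintro ⟨v', hv', hv⟩
    obtain rfl := signTwist.injective hv
    exact hv'
  · exact fun hv => ⟨v, hv, rfl⟩

theorem nonempty_cubeTetrahedral_mulEquiv : Nonempty (cubeTetrahedral ≃* Perm (Fin 4)) := by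
  obtain ⟨e⟩ := SignedPerm.nonempty_ker_signProd_mulEquiv
  exact ⟨((MulEquiv.subgroupCongr cubeTetrahedral_eq).trans
    (Subgroup.equivMapOfInjective _ _ toPerm_injective).symm).trans e⟩

theorem nonempty_cubeRotations_mulEquiv : Nonempty (cubeRotations ≃* Perm (Fin 4)) := by
  obtain ⟨e⟩ := SignedPerm.nonempty_ker_signProd_mulEquiv
  exact ⟨((MulEquiv.subgroupCongr cubeRotations_eq).trans
    (Subgroup.equivMapOfInjective _ _ toPerm_injective).symm).trans
      ((Subgroup.equivMapOfInjective _ _ signTwist.injective).trans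
        ((MulEquiv.subgroupCongr map_ker_det).trans e))⟩

/-! ### Signs and normalisers of the groups of the cube -/

/-- The permutation of the axes acts on two copies, one for each sign, so its parity cancels; each
sign `-1` swaps one pair of opposite faces. -/
theorem SignedPerm.sign_toPerm (w : SignedPerm) : Perm.sign (toPerm w) = signProd w := by
  have h1 : ∀ s : ℤˣ, Perm.sign (Equiv.mulLeft s) = s := by decide
  have h : toPerm w = prodCongrRight (fun k => Equiv.mulLeft (w.left k)) *
      prodCongrLeft fun _ => w.right :=
    Equiv.ext fun _ => rfl
  rw [h, map_mul, Perm.sign_prodCongrRight, Perm.sign_prodCongrLeft, signProd_apply]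
  simp [h1]

theorem sign_eq_one_of_mem_cubeTetrahedral {π : Perm CubeFace} (h : π ∈ cubeTetrahedral) :
    Perm.sign π = 1 := by
  rw [cubeTetrahedral_eq] at h
  obtain ⟨w, hw, rfl⟩ := h
  rw [sign_toPerm]
  exact hw

theorem exists_mem_cubeRotations_sign : ∃ π ∈ cubeRotations, Perm.sign π = -1 := by
  rw [cubeRotations_eq]
  -- The half turn exchanging `e₀` with `-e₁` and reversing `e₂`: it swaps three pairs of faces.
  refine ⟨_, ⟨⟨fun _ => -1, swap 0 1⟩, ?_, rfl⟩, ?_⟩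
  · change SignedPerm.det _ = 1
    rw [det_apply]
    decide
  · rw [sign_toPerm, signProd_apply]
    decide

/-- A permutation of the faces normalising the kernel of a character which is trivial on the half
turns is a product of a scalar and an element of the kernel, if the antipodal map is not in the
kernel. -/
theorem exists_eq_scalar_mul_of_mem_normalizer {χ : SignedPerm →* ℤˣ}
    (hs : ∀ s, χ (scalar s) = s) (ht : ∀ k, χ (halfTurn k) = 1) {π : Perm CubeFace}
    (hπ : ∀ t ∈ χ.ker.map toPerm, π * t * π⁻¹ ∈ χ.ker.map toPerm) :
    ∃ s, ∃ t ∈ χ.ker.map toPerm, π = toPerm (scalar s) * t := by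
  obtain ⟨w, rfl⟩ : π ∈ toPerm.range := by
    refine mem_range_toPerm fun f => ?_
    -- The half turn about the axis of `f` fixes only `f` and its opposite. Its conjugate by `π`
    -- fixes `π f` and, being a signed permutation, also the face opposite to `π f`; so `π` maps
    -- opposite faces to opposite faces.
    obtain ⟨v, -, hv⟩ := hπ _ ⟨halfTurn f.1, ht f.1, rfl⟩
    have hv' : ∀ x, toPerm v (π x) = π (toPerm (halfTurn f.1) x) := by
      intro x
      rw [hv]; simp
    have h1 : toPerm v (π f) = π f := by
      rw [hv', toPerm_halfTurn]; simp
    have h2 : toPerm v (toPerm (scalar (-1)) (π f)) = toPerm (scalar (-1)) (π f) := by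
      rw [← Perm.mul_apply, ← map_mul, ← scalar_mul, map_mul, Perm.mul_apply, h1]
    obtain ⟨x, hx⟩ := π.surjective (toPerm (scalar (-1)) (π f))
    rw [← hx, hv', π.injective.eq_iff] at h2
    have h3 : ∀ f x : CubeFace, toPerm (halfTurn f.1) x = x →
        x = f ∨ x = toPerm (scalar (-1)) f := by
      simp only [toPerm_halfTurn, toPerm_scalar]
      decide
    have h4 : ∀ f : CubeFace, f ≠ toPerm (scalar (-1)) f := by
      simp only [toPerm_scalar]
      decide
    rcases h3 f x h2 with rfl | rfl
    · exact absurd hx (h4 _)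
    · exact hx
  -- As `χ` is `-1` at the antipodal map, multiplying `w` by the scalar `χ w` brings it into the
  -- kernel.
  refine ⟨χ w, toPerm (scalar (χ w) * w), ⟨_, ?_, rfl⟩, ?_⟩
  · change χ _ = 1
    rw [map_mul, hs, ← sq, Int.units_sq]
  · rw [← map_mul, ← mul_assoc, ← map_mul, ← sq, Int.units_sq, map_one, one_mul]

/-! ### The copies of the groups of the cube in the symmetric group -/

section ViaEmbedding

variable {n : ℕ} (ι : CubeFace ↪ Fin n) (T : Subgroup (Perm CubeFace))

theorem apply_eq_of_mem_map_viaEmbeddingHom {ι : CubeFace ↪ Fin n} {T : Subgroup (Perm CubeFace)}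
    {g : Perm (Fin n)} (hg : g ∈ T.map (Perm.viaEmbeddingHom ι)) {y : Fin n}
    (hy : y ∉ Set.range ι) : g y = y := by
  obtain ⟨π, -, rfl⟩ := hg
  exact Perm.viaEmbedding_apply_of_notMem π ι y hy

theorem card_support_le_of_mem_map_viaEmbeddingHom {ι : CubeFace ↪ Fin n}
    {T : Subgroup (Perm CubeFace)} {g : Perm (Fin n)}
    (hg : g ∈ T.map (Perm.viaEmbeddingHom ι)) : g.support.card ≤ 6 := by
  have h : g.support ⊆ Finset.univ.map ι := by
    intro y hy
    by_contra h1
    refine Perm.mem_support.1 hy (apply_eq_of_mem_map_viaEmbeddingHom hg ?_)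
    simpa using h1
  refine (Finset.card_le_card h).trans ?_
  rw [Finset.card_map]
  decide

theorem sign_viaEmbeddingHom (π : Perm CubeFace) :
    Perm.sign (Perm.viaEmbeddingHom ι π) = Perm.sign π := by
  exact @Perm.sign_extendDomain _ _ _ _ _ _ π _ (fun _ => Classical.propDecidable _) _

theorem HasLargePowers.pow_eq_one_of_conj_mem {σ x : Perm (Fin n)} (h : HasLargePowers σ) {k : ℕ}
    (hx : x⁻¹ * σ ^ k * x ∈ T.map (Perm.viaEmbeddingHom ι)) : σ ^ k = 1 := by
  refine (h k).resolve_right fun h7 => ?_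
  have h1 := card_support_le_of_mem_map_viaEmbeddingHom hx
  have h2 : (x⁻¹ * σ ^ k * x).support.card = (σ ^ k).support.card := by
    simpa using Perm.card_support_conj (σ := x⁻¹) (τ := σ ^ k)
  omega

theorem exists_notMem_range (hn : 8 ≤ n) : ∃ y : Fin n, y ∉ Set.range ι := by
  by_contra! h
  have h1 := Fintype.card_le_of_surjective ι h
  have h2 : Fintype.card CubeFace = 6 := by decide
  rw [h2, Fintype.card_fin] at h1
  omega

/-- No nontrivial element stays in the group fixing the points outside the range of the embedding
under all the conjugations. -/
theorem eq_one_of_forall_conj_mem (hn : 8 ≤ n) {g : Perm (Fin n)}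
    (hg : ∀ x : Perm (Fin n), x * g * x⁻¹ ∈ T.map (Perm.viaEmbeddingHom ι)) : g = 1 := by
  obtain ⟨y, hy⟩ := exists_notMem_range ι hn
  ext1 x
  -- Conjugation by `swap x y` carries the point `x` to `y`, which lies outside the six points and
  -- is therefore fixed.
  have h := apply_eq_of_mem_map_viaEmbeddingHom (hg (swap x y)) hy
  rw [swap_inv, Perm.mul_apply, Perm.mul_apply, swap_apply_right, swap_apply_eq_iff,
    swap_apply_right] at h
  exact h

theorem normalCore_prod_eq_bot (hn : 8 ≤ n) (T' : Subgroup (Perm CubeFace)) :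
    ((T.map (Perm.viaEmbeddingHom ι)).prod (T'.map (Perm.viaEmbeddingHom ι))).normalCore = ⊥ := by
  rw [eq_bot_iff]
  rintro ⟨a, b⟩ h
  have ha : a = 1 := eq_one_of_forall_conj_mem ι T hn fun x => (h (x, 1)).1
  have hb : b = 1 := eq_one_of_forall_conj_mem ι T' hn fun x => (h (1, x)).2
  rw [ha, hb]
  exact one_mem _

theorem exists_sumEquiv : ∃ e : CubeFace ⊕ Fin (n - 6) ≃ Fin n, ∀ f, e (Sum.inl f) = ι f := by
  classical
  have hc : Fintype.card (Set.range ι : Set (Fin n)) = 6 := by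
    rw [Set.card_range_of_injective ι.injective]
    decide
  have hc' : Fintype.card ((Set.range ι)ᶜ : Set (Fin n)) = Fintype.card (Fin (n - 6)) := by
    rw [Fintype.card_compl_set, hc, Fintype.card_fin, Fintype.card_fin]
  exact ⟨(Equiv.sumCongr (Equiv.ofInjective ι ι.injective) (Fintype.equivOfCardEq hc').symm).trans
    (Equiv.Set.sumCompl (Set.range ι)), fun f => rfl⟩

/-- The permutations of a set preserving each of the two parts of a partition. -/
def sumPermHom {α β γ : Type*} (e : α ⊕ β ≃ γ) : Perm α × Perm β →* Perm γ :=
  (Equiv.permCongrHom e).toMonoidHom.comp (Perm.sumCongrHom α β)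

section SumPermHom

variable {α β γ : Type*} (e : α ⊕ β ≃ γ)

theorem sumPermHom_apply_inl (p : Perm α × Perm β) (a : α) :
    sumPermHom e p (e (Sum.inl a)) = e (Sum.inl (p.1 a)) := by
  simp [sumPermHom, Equiv.permCongrHom]

theorem sumPermHom_apply_inr (p : Perm α × Perm β) (b : β) :
    sumPermHom e p (e (Sum.inr b)) = e (Sum.inr (p.2 b)) := by
  simp [sumPermHom, Equiv.permCongrHom]

theorem sumPermHom_injective : Function.Injective (sumPermHom e) :=
  (Equiv.permCongrHom e).injective.comp Perm.sumCongrHom_injective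

theorem mem_range_sumPermHom [Finite α] [Finite β] {g : Perm γ}
    (h : ∀ a, ∃ a', g (e (Sum.inl a)) = e (Sum.inl a')) : g ∈ (sumPermHom e).range := by
  have h1 : (Equiv.permCongrHom e).symm g ∈ (Perm.sumCongrHom α β).range := by
    refine Perm.mem_sumCongrHom_range_of_perm_mapsTo_inl ?_
    rintro _ ⟨a, rfl⟩
    obtain ⟨a', ha'⟩ := h a
    refine ⟨a', ?_⟩
    change _ = e.symm (g (e (Sum.inl a)))
    rw [ha', Equiv.symm_apply_apply]
  obtain ⟨p, hp⟩ := h1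
  exact ⟨p, by rw [sumPermHom, MonoidHom.comp_apply, hp]; exact MulEquiv.apply_symm_apply _ _⟩

end SumPermHom

theorem viaEmbeddingHom_eq_sumPermHom {ι : CubeFace ↪ Fin n} {e : CubeFace ⊕ Fin (n - 6) ≃ Fin n}
    (he : ∀ f, e (Sum.inl f) = ι f) (π : Perm CubeFace) :
    Perm.viaEmbeddingHom ι π = sumPermHom e (π, 1) := by
  ext1 y
  obtain ⟨y | y, rfl⟩ := e.surjective y
  · rw [sumPermHom_apply_inl, he, he]
    exact Perm.viaEmbedding_apply π ι y
  · rw [sumPermHom_apply_inr]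
    refine Perm.viaEmbedding_apply_of_notMem π ι _ ?_
    rintro ⟨f, hf⟩
    rw [← he, e.injective.eq_iff] at hf
    cases hf

/-- The embedding of `S₂ × Sₙ₋₆` in `Sₙ` as the group generated by the antipodal map of the cube
and the permutations fixing the faces of the cube. -/
def complementHom (e : CubeFace ⊕ Fin (n - 6) ≃ Fin n) :
    Perm (Fin 2) × Perm (Fin (n - 6)) →* Perm (Fin n) :=
  (sumPermHom e).comp (((toPerm.comp scalar).comp Perm.sign).prodMap (MonoidHom.id _))

theorem complementHom_apply (e : CubeFace ⊕ Fin (n - 6) ≃ Fin n)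
    (p : Perm (Fin 2) × Perm (Fin (n - 6))) :
    complementHom e p = sumPermHom e (toPerm (scalar (Perm.sign p.1)), p.2) := rfl

/-- These elements even centralise the group: the scalars are central among the signed permutations,
and the other factor moves only the remaining points. -/
theorem complementHom_mem_normalizer {ι : CubeFace ↪ Fin n} {e : CubeFace ⊕ Fin (n - 6) ≃ Fin n}
    (he : ∀ f, e (Sum.inl f) = ι f) {χ : SignedPerm →* ℤˣ}
    (p : Perm (Fin 2) × Perm (Fin (n - 6))) :
    complementHom e p ∈
      Subgroup.normalizer (((χ.ker.map toPerm).map (Perm.viaEmbeddingHom ι) :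
        Subgroup (Perm (Fin n))) : Set (Perm (Fin n))) := by
  refine Subgroup.centralizer_le_normalizer _ (Subgroup.mem_centralizer_iff.2 ?_)
  rintro _ ⟨_, ⟨w, -, rfl⟩, rfl⟩
  rw [viaEmbeddingHom_eq_sumPermHom he, complementHom_apply, ← map_mul, ← map_mul, Prod.mk_mul_mk,
    Prod.mk_mul_mk, ← map_mul, ← map_mul, scalar_mul, one_mul, mul_one]

theorem eq_one_of_complementHom_mem {ι : CubeFace ↪ Fin n} {e : CubeFace ⊕ Fin (n - 6) ≃ Fin n}
    (he : ∀ f, e (Sum.inl f) = ι f) {χ : SignedPerm →* ℤˣ} (hs : ∀ s, χ (scalar s) = s)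
    (p : Perm (Fin 2) × Perm (Fin (n - 6)))
    (hp : complementHom e p ∈ (χ.ker.map toPerm).map (Perm.viaEmbeddingHom ι)) : p = 1 := by
  obtain ⟨_, ⟨w, hw, rfl⟩, h⟩ := hp
  rw [viaEmbeddingHom_eq_sumPermHom he, complementHom_apply,
    (sumPermHom_injective e).eq_iff, Prod.mk.injEq, toPerm_injective.eq_iff] at h
  have h1 : χ w = 1 := hw
  rw [h.1, hs] at h1
  have h2 : ∀ q : Perm (Fin 2), Perm.sign q = 1 → q = 1 := by decide
  exact Prod.ext (h2 _ h1) h.2.symm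

/-- A normalising element preserves the set of six points, because the group moves each of them and
fixes all the others. Its restriction to the faces is then a scalar times an element of the kernel,
and its restriction to the other points is arbitrary. -/
theorem exists_eq_complementHom_mul {ι : CubeFace ↪ Fin n} {e : CubeFace ⊕ Fin (n - 6) ≃ Fin n}
    (he : ∀ f, e (Sum.inl f) = ι f) {χ : SignedPerm →* ℤˣ} (hs : ∀ s, χ (scalar s) = s)
    (ht : ∀ k, χ (halfTurn k) = 1) {g : Perm (Fin n)}
    (hg : g ∈ Subgroup.normalizer (((χ.ker.map toPerm).map (Perm.viaEmbeddingHom ι) :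
        Subgroup (Perm (Fin n))) : Set (Perm (Fin n)))) :
    ∃ p, ∃ a ∈ (χ.ker.map toPerm).map (Perm.viaEmbeddingHom ι), g = complementHom e p * a := by
  have hconj : ∀ w ∈ χ.ker, ∃ v ∈ χ.ker,
      sumPermHom e (toPerm v, 1) * g = g * sumPermHom e (toPerm w, 1) := by
    intro w hw
    obtain ⟨_, ⟨v, hv, rfl⟩, h⟩ := (Subgroup.mem_normalizer_iff.1 hg _).1
      ⟨_, ⟨w, hw, rfl⟩, rfl⟩
    refine ⟨v, hv, ?_⟩
    rw [← viaEmbeddingHom_eq_sumPermHom he, ← viaEmbeddingHom_eq_sumPermHom he, h,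
      inv_mul_cancel_right]
  obtain ⟨⟨π, τ⟩, rfl⟩ : g ∈ (sumPermHom e).range := by
    refine mem_range_sumPermHom e fun f => ?_
    -- The half turn about an axis other than that of `f` moves `f`; were `g` to send `f` outside
    -- the six points, the conjugate would fix that image, a contradiction.
    obtain ⟨v, -, hv⟩ := hconj (halfTurn (f.1 + 1)) (ht _)
    have h1 := DFunLike.congr_fun hv (e (Sum.inl f))
    rw [Perm.mul_apply, Perm.mul_apply, sumPermHom_apply_inl] at h1
    obtain ⟨y | y, hy⟩ := e.surjective (g (e (Sum.inl f)))
    · exact ⟨y, hy.symm⟩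
    · rw [← hy, sumPermHom_apply_inr, Perm.one_apply, hy, g.injective.eq_iff, e.injective.eq_iff,
        Sum.inl.injEq, toPerm_halfTurn] at h1
      have h2 : ∀ f : CubeFace, f ≠ (f.1, (if f.1 = f.1 + 1 then 1 else -1) * f.2) := by decide
      exact absurd h1 (h2 f)
  obtain ⟨s, t, ht', hπ⟩ := exists_eq_scalar_mul_of_mem_normalizer hs ht (π := π) (by
    rintro _ ⟨w, hw, rfl⟩
    obtain ⟨v, hv, h⟩ := hconj w hw
    rw [← map_mul, ← map_mul, (sumPermHom_injective e).eq_iff] at h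
    refine ⟨v, hv, ?_⟩
    rw [eq_mul_inv_iff_mul_eq]
    exact congrArg Prod.fst h)
  obtain ⟨q, hq⟩ : ∃ q : Perm (Fin 2), Perm.sign q = s := by
    clear hπ
    revert s; decide
  refine ⟨(q, τ), _, ⟨t, ht', rfl⟩, ?_⟩
  rw [viaEmbeddingHom_eq_sumPermHom he, complementHom_apply, ← map_mul, hπ, hq, Prod.mk_mul_mk,
    mul_one]

end ViaEmbedding

/-! ### The four coset dessins -/

theorem Subgroup.mem_normalizer_prod_iff {G G' : Type*} [Group G] [Group G'] {A : Subgroup G}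
    {B : Subgroup G'} {g : G × G'} :
    g ∈ Subgroup.normalizer ((A.prod B : Subgroup (G × G')) : Set (G × G')) ↔
      g.1 ∈ Subgroup.normalizer (A : Set G) ∧ g.2 ∈ Subgroup.normalizer (B : Set G') := by
  simp only [Subgroup.mem_normalizer_iff, Subgroup.mem_prod]
  constructor
  · exact fun h => ⟨fun a => by simpa using h (a, 1), fun b => by simpa using h (1, b)⟩
  · exact fun h x => and_congr (h.1 x.1) (h.2 x.2)

/-- A character of `SignedPerm` which is one of the two characters whose kernels act on the faces
of the cube as the tetrahedral and the rotation group. -/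
def IsCubeCharacter (χ : SignedPerm →* ℤˣ) : Prop := χ = det ∨ χ = signProd

/-- The kernel of a character of `SignedPerm`, as a group of permutations of the `n` points. -/
noncomputable def kerIn {n : ℕ} (ι : CubeFace ↪ Fin n) (χ : SignedPerm →* ℤˣ) :
    Subgroup (Perm (Fin n)) :=
  (χ.ker.map toPerm).map (Perm.viaEmbeddingHom ι)

namespace IsCubeCharacter

variable {χ : SignedPerm →* ℤˣ}

theorem apply_scalar (h : IsCubeCharacter χ) (s : ℤˣ) : χ (scalar s) = s := by
  rcases h with rfl | rfl
  exacts [det_scalar s, signProd_scalar s]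

theorem apply_halfTurn (h : IsCubeCharacter χ) (k : Fin 3) : χ (halfTurn k) = 1 := by
  rcases h with rfl | rfl
  exacts [det_halfTurn k, signProd_halfTurn k]

theorem nonempty_kerIn_mulEquiv (h : IsCubeCharacter χ) {n : ℕ} (ι : CubeFace ↪ Fin n) :
    Nonempty (kerIn ι χ ≃* Perm (Fin 4)) := by
  have h1 : Nonempty (χ.ker.map toPerm ≃* Perm (Fin 4)) := by
    rcases h with rfl | rfl
    · rw [← cubeRotations_eq]; exact nonempty_cubeRotations_mulEquiv
    · rw [← cubeTetrahedral_eq]; exact nonempty_cubeTetrahedral_mulEquiv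
  obtain ⟨e⟩ := h1
  exact ⟨(Subgroup.equivMapOfInjective _ _ (Perm.viaEmbeddingHom_injective ι)).symm.trans e⟩

end IsCubeCharacter

section Prod

variable {n : ℕ} (ι : CubeFace ↪ Fin n) {χ χ' : SignedPerm →* ℤˣ}

theorem nonempty_prod_kerIn_mulEquiv (h : IsCubeCharacter χ) (h' : IsCubeCharacter χ') :
    Nonempty ((kerIn ι χ).prod (kerIn ι χ') ≃* Perm (Fin 4) × Perm (Fin 4)) := by
  obtain ⟨e⟩ := h.nonempty_kerIn_mulEquiv ι
  obtain ⟨e'⟩ := h'.nonempty_kerIn_mulEquiv ι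
  exact ⟨(Subgroup.prodEquiv _ _).trans (e.prodCongr e')⟩

theorem index_prod_kerIn (hn : 8 ≤ n) (h : IsCubeCharacter χ) (h' : IsCubeCharacter χ') :
    ((kerIn ι χ).prod (kerIn ι χ')).index = (n.factorial / Nat.factorial 4) ^ 2 := by
  obtain ⟨e⟩ := nonempty_prod_kerIn_mulEquiv ι h h'
  have h1 := ((kerIn ι χ).prod (kerIn ι χ')).card_mul_index
  rw [Nat.card_congr e.toEquiv, Nat.card_prod, Nat.card_prod, Nat.card_perm, Nat.card_perm,
    Nat.card_fin, Nat.card_fin] at h1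
  obtain ⟨q, hq⟩ := Nat.factorial_dvd_factorial (show 4 ≤ n by omega)
  have h4 : 0 < Nat.factorial 4 := Nat.factorial_pos 4
  rw [hq] at h1 ⊢
  rw [Nat.mul_div_cancel_left _ h4]
  refine Nat.eq_of_mul_eq_mul_left (Nat.mul_pos h4 h4) (h1.trans ?_)
  ring

theorem pow_eq_one_of_conj_mem_prod {a b : Perm (Fin n)} (ha : HasLargePowers a)
    (hb : HasLargePowers b) (k : ℕ) (x : Perm (Fin n) × Perm (Fin n))
    (hx : x⁻¹ * (a, b) ^ k * x ∈ (kerIn ι χ).prod (kerIn ι χ')) : (a, b) ^ k = 1 :=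
  Prod.ext (ha.pow_eq_one_of_conj_mem ι _ hx.1) (hb.pow_eq_one_of_conj_mem ι _ hx.2)

theorem nonempty_automorphismGroup_prod_kerIn (h : IsCubeCharacter χ) (h' : IsCubeCharacter χ')
    {m₀ m₁ : Perm (Fin n) × Perm (Fin n)} (hgen : Subgroup.closure {m₀, m₁} = ⊤) :
    Nonempty ((Dessin.ofCosets ((kerIn ι χ).prod (kerIn ι χ')) m₀ m₁ hgen).automorphismGroup ≃*
      (Perm (Fin 2) × Perm (Fin (n - 6))) × (Perm (Fin 2) × Perm (Fin (n - 6)))) := by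
  obtain ⟨e, he⟩ := exists_sumEquiv ι
  refine Dessin.nonempty_automorphismGroup_mulEquiv _ hgen
    ((complementHom e).prodMap (complementHom e)) (fun p => ?_) (fun p hp => ?_) fun g hg => ?_
  · exact Subgroup.mem_normalizer_prod_iff.2
      ⟨complementHom_mem_normalizer he p.1, complementHom_mem_normalizer he p.2⟩
  · exact Prod.ext (eq_one_of_complementHom_mem he h.apply_scalar p.1 hp.1)
      (eq_one_of_complementHom_mem he h'.apply_scalar p.2 hp.2)
  · obtain ⟨h1, h2⟩ := Subgroup.mem_normalizer_prod_iff.1 hg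
    obtain ⟨p, a, ha, hpa⟩ := exists_eq_complementHom_mul he h.apply_scalar h.apply_halfTurn h1
    obtain ⟨q, b, hb, hqb⟩ := exists_eq_complementHom_mul he h'.apply_scalar h'.apply_halfTurn h2
    exact ⟨(p, q), (a, b), ⟨ha, hb⟩, Prod.ext hpa hqb⟩

theorem kerIn_signProd_le : kerIn ι signProd ≤ Perm.sign.ker := by
  rintro _ ⟨π, hπ, rfl⟩
  rw [← cubeTetrahedral_eq] at hπ
  rw [MonoidHom.mem_ker, sign_viaEmbeddingHom]
  exact sign_eq_one_of_mem_cubeTetrahedral hπ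

theorem not_kerIn_det_le : ¬ kerIn ι det ≤ Perm.sign.ker := by
  obtain ⟨π, hπ, h⟩ := exists_mem_cubeRotations_sign
  rw [cubeRotations_eq] at hπ
  intro hle
  have h1 := hle ⟨π, hπ, rfl⟩
  rw [MonoidHom.mem_ker, sign_viaEmbeddingHom, h] at h1
  exact absurd h1 (by decide)

end Prod

/-- The characters of a product of two symmetric groups with values `±1` which are trivial on a
product of two subgroups, in terms of the parities of the two factors. -/
theorem exists_character_iff {n : ℕ} {A A' : Subgroup (Perm (Fin n))} {E E' : Bool}
    (hA : A ≤ Perm.sign.ker ↔ E = true) (hA' : A' ≤ Perm.sign.ker ↔ E' = true)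
    (a b : Perm (Fin n) × Perm (Fin n)) :
    (∃ θ : Perm (Fin n) × Perm (Fin n) →* ℤˣ, θ a = -1 ∧ θ b = -1 ∧ A.prod A' ≤ θ.ker) ↔
      ∃ s t : Fin 2, (s = 0 ∨ E = true) ∧ (t = 0 ∨ E' = true) ∧
        Perm.sign a.1 ^ s.val * Perm.sign a.2 ^ t.val = -1 ∧
        Perm.sign b.1 ^ s.val * Perm.sign b.2 ^ t.val = -1 := by
  have hex : ∀ θ : Perm (Fin n) →* ℤˣ, ∃ s : Fin 2, ∀ g, θ g = Perm.sign g ^ s.val := by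
    intro θ
    rcases Perm.hom_eq_one_or_sign θ with rfl | rfl
    · exact ⟨0, fun g => by simp⟩
    · exact ⟨1, fun g => by simp⟩
  have hle : ∀ {θ : Perm (Fin n) →* ℤˣ} {s : Fin 2}, (∀ g, θ g = Perm.sign g ^ s.val) →
      ∀ {B : Subgroup (Perm (Fin n))} {F : Bool}, (B ≤ Perm.sign.ker ↔ F = true) →
      (B ≤ θ.ker ↔ s = 0 ∨ F = true) := by
    intro θ s hθ B F hB
    rw [← hB]
    fin_cases s
    · simp only [Fin.zero_eta, true_or, iff_true]
      intro g _
      simp [MonoidHom.mem_ker, hθ]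
    · have : θ = Perm.sign := MonoidHom.ext fun g => by simp [hθ]
      simp [this]
  constructor
  · rintro ⟨θ, ha, hb, hθ⟩
    obtain ⟨s, hs⟩ := hex (θ.comp (MonoidHom.inl _ _))
    obtain ⟨t, ht⟩ := hex (θ.comp (MonoidHom.inr _ _))
    have hst : ∀ g, θ g = Perm.sign g.1 ^ s.val * Perm.sign g.2 ^ t.val := by
      intro g
      rw [← hs, ← ht, MonoidHom.comp_apply, MonoidHom.comp_apply, ← map_mul]
      simp
    refine ⟨s, t, (hle hs hA).1 fun g hg => ?_, (hle ht hA').1 fun g hg => ?_, ?_, ?_⟩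
    · exact hθ ⟨hg, one_mem _⟩
    · exact hθ ⟨one_mem _, hg⟩
    · rw [← hst, ha]
    · rw [← hst, hb]
  · rintro ⟨s, t, hs, ht, ha, hb⟩
    let χ : Fin 2 → Perm (Fin n) →* ℤˣ := fun s => Perm.sign ^ s.val
    have hχ : ∀ (s : Fin 2) g, χ s g = Perm.sign g ^ s.val := fun _ _ => rfl
    refine ⟨(χ s).coprod (χ t), ha, hb, fun g hg => ?_⟩
    have h1 : χ s g.1 = 1 := (hle (hχ s) hA).2 hs hg.1
    have h2 : χ t g.2 = 1 := (hle (hχ t) hA').2 ht hg.2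
    rw [MonoidHom.mem_ker, MonoidHom.coprod_apply, h1, h2, one_mul]

/-- The characters defining the first factors of the four edge stabilisers. -/
def firstCharacter : Fin 4 → SignedPerm →* ℤˣ := ![det, det, signProd, signProd]

/-- The characters defining the second factors of the four edge stabilisers. -/
def secondCharacter : Fin 4 → SignedPerm →* ℤˣ := ![det, signProd, det, signProd]

theorem isCubeCharacter_firstCharacter (i : Fin 4) : IsCubeCharacter (firstCharacter i) := by
  fin_cases i
  exacts [Or.inl rfl, Or.inl rfl, Or.inr rfl, Or.inr rfl]

theorem isCubeCharacter_secondCharacter (i : Fin 4) : IsCubeCharacter (secondCharacter i) := by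
  fin_cases i
  exacts [Or.inl rfl, Or.inr rfl, Or.inl rfl, Or.inr rfl]

section CubeStabilizer

variable {n : ℕ} (ι : CubeFace ↪ Fin n)

theorem cubeStabilizer_eq (i : Fin 4) : cubeStabilizer ι i =
    (kerIn ι (firstCharacter i)).prod (kerIn ι (secondCharacter i)) := by
  have hA : tetrahedralIn ι = kerIn ι signProd := by
    rw [tetrahedralIn, cubeTetrahedral_eq]; rfl
  have hB : rotationsIn ι = kerIn ι det := by
    rw [rotationsIn, cubeRotations_eq]; rfl
  unfold cubeStabilizer
  rw [hA, hB]
  fin_cases i <;> rfl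

theorem kerIn_firstCharacter_le_iff (i : Fin 4) : kerIn ι (firstCharacter i) ≤ Perm.sign.ker ↔
    ![false, false, true, true] i = true := by
  fin_cases i
  · exact iff_of_false (not_kerIn_det_le ι) (by decide)
  · exact iff_of_false (not_kerIn_det_le ι) (by decide)
  · exact iff_of_true (kerIn_signProd_le ι) rfl
  · exact iff_of_true (kerIn_signProd_le ι) rfl

theorem kerIn_secondCharacter_le_iff (i : Fin 4) : kerIn ι (secondCharacter i) ≤ Perm.sign.ker ↔
    ![false, true, false, true] i = true := by
  fin_cases i
  · exact iff_of_false (not_kerIn_det_le ι) (by decide)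
  · exact iff_of_true (kerIn_signProd_le ι) rfl
  · exact iff_of_false (not_kerIn_det_le ι) (by decide)
  · exact iff_of_true (kerIn_signProd_le ι) rfl

/-- Characters are invariant under conjugation, and the four subgroups differ in which of the two
coordinate signs are trivial on them. -/
theorem map_conj_cubeStabilizer_ne {i j : Fin 4} (hij : i ≠ j)
    (g : Perm (Fin n) × Perm (Fin n)) :
    (cubeStabilizer ι i).map (MulAut.conj g).toMonoidHom ≠ cubeStabilizer ι j := by
  intro h
  have hconj : ∀ θ : Perm (Fin n) × Perm (Fin n) →* ℤˣ,
      cubeStabilizer ι i ≤ θ.ker ↔ cubeStabilizer ι j ≤ θ.ker := by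
    intro θ
    rw [← h, Subgroup.map_le_iff_le_comap]
    have : θ.ker.comap (MulAut.conj g).toMonoidHom = θ.ker := by
      ext x
      change θ (g * x * g⁻¹) = 1 ↔ θ x = 1
      rw [map_mul, map_mul, map_inv, mul_comm, inv_mul_cancel_left]
    rw [this]
  have hfst : ∀ i, cubeStabilizer ι i ≤ (Perm.sign.comp (MonoidHom.fst _ _)).ker ↔
      ![false, false, true, true] i = true := by
    intro i
    rw [← kerIn_firstCharacter_le_iff ι, cubeStabilizer_eq]
    exact ⟨fun h x hx => h (show (x, 1) ∈ _ from ⟨hx, one_mem _⟩), fun h x hx => h hx.1⟩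
  have hsnd : ∀ i, cubeStabilizer ι i ≤ (Perm.sign.comp (MonoidHom.snd _ _)).ker ↔
      ![false, true, false, true] i = true := by
    intro i
    rw [← kerIn_secondCharacter_le_iff ι, cubeStabilizer_eq]
    exact ⟨fun h x hx => h (show (1, x) ∈ _ from ⟨one_mem _, hx⟩), fun h x hx => h hx.2⟩
  have h1 := hconj (Perm.sign.comp (MonoidHom.fst _ _))
  have h2 := hconj (Perm.sign.comp (MonoidHom.snd _ _))
  rw [hfst, hfst] at h1
  rw [hsnd, hsnd] at h2
  clear h hconj hfst hsnd
  revert i j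
  decide

theorem normalCore_cubeStabilizer (hn : 8 ≤ n) (i : Fin 4) :
    (cubeStabilizer ι i).normalCore = ⊥ := by
  rw [cubeStabilizer_eq]
  exact normalCore_prod_eq_bot ι _ hn _

theorem index_cubeStabilizer (hn : 8 ≤ n) (i : Fin 4) :
    (cubeStabilizer ι i).index = (n.factorial / Nat.factorial 4) ^ 2 := by
  rw [cubeStabilizer_eq]
  exact index_prod_kerIn ι hn (isCubeCharacter_firstCharacter i)
    (isCubeCharacter_secondCharacter i)

theorem exists_character_cubeStabilizer_iff (i : Fin 4) (a b : Perm (Fin n) × Perm (Fin n)) :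
    (∃ θ : Perm (Fin n) × Perm (Fin n) →* ℤˣ, θ a = -1 ∧ θ b = -1 ∧
        cubeStabilizer ι i ≤ θ.ker) ↔
      ∃ s t : Fin 2, (s = 0 ∨ ![false, false, true, true] i = true) ∧
        (t = 0 ∨ ![false, true, false, true] i = true) ∧
        Perm.sign a.1 ^ s.val * Perm.sign a.2 ^ t.val = -1 ∧
        Perm.sign b.1 ^ s.val * Perm.sign b.2 ^ t.val = -1 := by
  rw [cubeStabilizer_eq]
  exact exists_character_iff (kerIn_firstCharacter_le_iff ι i)
    (kerIn_secondCharacter_le_iff ι i) a b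

end CubeStabilizer

theorem theorem1p2 :
    Nonempty (cubeTetrahedral ≃* Perm (Fin 4)) ∧ Nonempty (cubeRotations ≃* Perm (Fin 4)) ∧
    (∀ g : Perm CubeFace,
      cubeTetrahedral.map (MulAut.conj g).toMonoidHom ≠ cubeRotations) ∧
    ∀ (n : ℕ), 8 ≤ n → ∀ (ι : CubeFace ↪ Fin n),
      ∃ (m₀ m₁ : Perm (Fin n) × Perm (Fin n)) (hgen : Subgroup.closure {m₀, m₁} = ⊤),
        let H : Fin 4 → Subgroup (Perm (Fin n) × Perm (Fin n)) := cubeStabilizer ι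
        let D : (i : Fin 4) → Dessin ((Perm (Fin n) × Perm (Fin n)) ⧸ H i) :=
          fun i => Dessin.ofCosets (H i) m₀ m₁ hgen
        (∀ i j, i ≠ j → ∀ g : Perm (Fin n) × Perm (Fin n),
          (H i).map (MulAut.conj g).toMonoidHom ≠ H j) ∧
        (∀ i, (D i).degree = (n.factorial / Nat.factorial 4) ^ 2) ∧
        (∀ i, (D i).IsUniform) ∧
        (∀ i j, (D i).type = (D j).type) ∧
        (∀ i j, (D i).passport = (D j).passport) ∧
        (∀ i, Nonempty ((D i).monodromyGroup ≃* Perm (Fin n) × Perm (Fin n))) ∧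
        (∀ i e, Nonempty ((D i).edgeStabilizer e ≃* Perm (Fin 4) × Perm (Fin 4))) ∧
        (∀ i, Nonempty ((D i).automorphismGroup ≃*
          (Perm (Fin 2) × Perm (Fin (n - 6))) × (Perm (Fin 2) × Perm (Fin (n - 6))))) ∧
        (D 0).tot = 0 ∧ (D 1).tot = 1 ∧ (D 2).tot = 1 ∧ (D 3).tot = 3 ∧
        (D 2).IsZOrientable ∧ ¬ (D 1).IsZOrientable := by
  refine ⟨nonempty_cubeTetrahedral_mulEquiv, nonempty_cubeRotations_mulEquiv, fun g h => ?_,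
    fun n hn ι => ?_⟩
  · obtain ⟨π, hπ, hsign⟩ := exists_mem_cubeRotations_sign
    rw [← h] at hπ
    obtain ⟨ρ, hρ, rfl⟩ := hπ
    have h1 : Perm.sign (g * ρ * g⁻¹) = -1 := hsign
    rw [map_mul, map_mul, sign_eq_one_of_mem_cubeTetrahedral hρ, mul_one, Perm.sign_inv, ← sq,
      Int.units_sq] at h1
    exact absurd h1 (by decide)
  obtain ⟨x, y, z, hz, hsx, hsy, hsz, hxy, hx, hy, hz7, hxz, hyz⟩ := exists_generators n hn
  have hinf : (((x, z) : Perm (Fin n) × Perm (Fin n)) * (y, x))⁻¹ = (z, y) := by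
    simp [hz, mul_assoc]
  refine ⟨(x, z), (y, x), closure_pair_eq_top hz hxy hxz hyz, ?_⟩
  generalize closure_pair_eq_top hz hxy hxz hyz = hgen
  intro H D
  -- All entries of the three pairs have large powers, so none of their nontrivial powers is
  -- conjugate into `Hᵢ`.
  have hpass := fun i => Dessin.passport_ofCosets (cubeStabilizer ι i) hgen
    (by rw [cubeStabilizer_eq]; exact pow_eq_one_of_conj_mem_prod ι hx hz7)
    (by rw [cubeStabilizer_eq]; exact pow_eq_one_of_conj_mem_prod ι hy hx)
    (by rw [cubeStabilizer_eq, hinf]; exact pow_eq_one_of_conj_mem_prod ι hz7 hy)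
  have hpass' : ∀ i j, (D i).passport = (D j).passport := by
    intro i j
    refine (hpass i).trans (Eq.trans ?_ (hpass j).symm)
    rw [index_cubeStabilizer ι hn, index_cubeStabilizer ι hn]
  have horient := fun i =>
    (Dessin.isZOrientable_ofCosets (H i) hgen).trans
      (exists_character_cubeStabilizer_iff ι i (x, z) (y, x))
  simp only [hsx, hsy, hsz] at horient
  -- The coordinate signs of `m₀ = (x, z)`, `m₁ = (y, x)`, `m∞ = (z, y)`. With them the count of
  -- orientable twists becomes a finite check independent of `n`.
  let u : Fin 3 → ℤˣ × ℤˣ := ![(-1, 1), (-1, -1), (1, -1)]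
  have hu : ∀ k, (Perm.sign (![(x, z), (y, x), ((x, z) * (y, x))⁻¹] k).1,
      Perm.sign (![(x, z), (y, x), ((x, z) * (y, x))⁻¹] k).2) = u k := by
    rw [hinf]
    intro k
    fin_cases k <;> simp [u, hsx, hsy, hsz]
  have htot : ∀ i, (D i).tot = (Finset.univ.filter fun k : Fin 3 =>
      ∃ s t : Fin 2, (s = 0 ∨ ![false, false, true, true] i = true) ∧
        (t = 0 ∨ ![false, true, false, true] i = true) ∧
        (u k).1 ^ s.val * (u k).2 ^ t.val = -1 ∧
        (u (k + 1)).1 ^ s.val * (u (k + 1)).2 ^ t.val = -1).card := by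
    intro i
    refine Dessin.tot_ofCosets (H i) hgen _ fun k => ?_
    rw [exists_character_cubeStabilizer_iff, ← hu, ← hu]
  refine ⟨fun i j hij g => map_conj_cubeStabilizer_ne ι hij g, index_cubeStabilizer ι hn,
    fun i => Dessin.isUniform_of_passport _ (hpass i),
    fun i j => Dessin.type_eq_of_passport_eq (hpass' i j), hpass',
    fun i => Dessin.nonempty_monodromyGroup_mulEquiv _ hgen (normalCore_cubeStabilizer ι hn i),
    fun i e => ?_, fun i => ?_, (htot 0).trans (by decide), (htot 1).trans (by decide),
    (htot 2).trans (by decide), (htot 3).trans (by decide), (horient 2).2 (by decide),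
    fun h => absurd ((horient 1).1 h) (by decide)⟩
  · obtain ⟨f⟩ := Dessin.nonempty_edgeStabilizer_mulEquiv (H i) hgen
      (normalCore_cubeStabilizer ι hn i) e
    obtain ⟨f'⟩ := nonempty_prod_kerIn_mulEquiv ι (isCubeCharacter_firstCharacter i)
      (isCubeCharacter_secondCharacter i)
    exact ⟨f.trans ((MulEquiv.subgroupCongr (cubeStabilizer_eq ι i)).trans f')⟩
  · have h := nonempty_automorphismGroup_prod_kerIn ι (isCubeCharacter_firstCharacter i)
      (isCubeCharacter_secondCharacter i) hgen
    rw [← cubeStabilizer_eq] at h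
    exact h
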